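/- All systems are finite-dimensional; a channel is a completely positive trace-preserving map, and the Choi state of a channel $\mathcal N$ on $A$ is $(\mathrm{id}_A\otimes\mathcal N)(\Phi)$, with $\Phi$ the maximally entangled state on $A\otimes A$. The quantum capacity $Q(\mathcal N)$ is the supremum of the rates $R\ge 0$ such that for every $\varepsilon>0$ and all sufficiently large $n$ there are an integer $K\ge 2^{n(R-\varepsilon)}$, $K\ge1$, and encoding and decoding channels for $n$ uses of $\mathcal N$ that transmit one half of a maximally entangled state of Schmidt rank $K$ with fidelity at least $1-\varepsilon$. For integers $d\ge 2$, $m\ge 0$ let $\rho_s,\rho_a$ be the normalized projectors onto the symmetric and antisymmetric subspaces of $\mathbb C^d\otimes\mathbb C^d$, and put $\tau_1=\big(\tfrac{\rho_s+\rho_a}{2}\big)^{\otimes m}$ and $\tau_2=\rho_s^{\otimes m}$ on the shield $A'B'$. With $\Phi_\pm$ the projectors onto $(|00\rangle\pm|11\rangle)/\sqrt2$ and $\omega=\tfrac12(|01\rangle\langle01|+|10\rangle\langle10|)$ on the key qubits $AB$, let $$\gamma_{\pm}(p,d,m)=\tfrac p2\big(\Phi_\pm\otimes\tau_1+\Phi_\mp\otimes\tau_2\big)+(1-p)\,\omega\otimes\tau_2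 ,$$ a state of $AA'$ and $BB'$. The parameters are called admissible if $0<p\le\tfrac23$ and $\big(\tfrac d{d-1}\big)^m\le\tfrac{2-p}{p}$; for $0<p\le1$ and $m\ge1$ this is equivalent to $\gamma_\pm(p,d,m)$ having positive partial transpose, and for $p\in(\tfrac14,\tfrac13)$ the first condition is automatic. Let $k\ge 2$ and let $(p,d,m)$ and $(p',d',m')$ be admissible. Let $\mathcal N_H$ be the channel whose Choi state is the $k$-hybrid state $$\rho=\tfrac1k\,\gamma_+(p,d,m)+\tfrac{k-1}{k}\,\tfrac{\mathbb 1^{AA'}}{\dim AA'}\otimes|e\rangle\langle e| ,$$ where $|e\rangle$ is a unit vector (the erasure flag) orthogonal to $BB'$ in the enlarged output space $BB'\oplus\mathbb C|e\rangle$, and let $\mathcal N_\gamma$ be the channel whose Choi state is $\gamma_s(p',d',m')$, for either sign $s$. Let $\mathcal N_e^q(X)=(1-q)X+q\,\mathrm{Tr}(X)\,|e\rangle\langle e|$ be the erasure channel on $\mathbb C^D$, $D\ge1$, with erasure probability $q$. Then the channels $\mathcal N_H$ and $\mathcal N_\gamma$ exist, and $$Q(\mathcal N_H)=0,\qquad Q(\mathcal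 N_H\otimes\mathcal N_\gamma)=0,\qquad Q(\mathcal N_H\otimes\mathcal N_e^q)=0\quad\text{for all } q\in[\tfrac12,1)\text{ and all }D\ge1 .$$ -/

import Mathlib

open scoped Kronecker ENNReal NNReal ComplexOrder

noncomputable section

namespace QuantumChannel

/-! ### Finite-dimensional quantum channels

A quantum system is given by a finite index set `A` of basis vectors (the Hilbert space is `ℂ^A`),
its operators are the matrices `Matrix A A ℂ`, and the composite of `A` and `B` is `A × B`. -/

/-- Linear maps from the operators on `ℂ^A` to the operators on `ℂ^B`. -/
abbrev SuperOp (A B : Type*) := Matrix A A ℂ →ₗ[ℂ] Matrix B B ℂ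

/-- The map `id_R ⊗ N` applied to an operator on `R ⊗ A`. -/
def ampliate {A B : Type*} (R : Type*) (N : SuperOp A B)
    (X : Matrix (R × A) (R × A) ℂ) : Matrix (R × B) (R × B) ℂ :=
  Matrix.of fun x y => N (Matrix.of fun a a' => X (x.1, a) (y.1, a')) x.2 y.2

/-- Complete positivity: `id_r ⊗ N` preserves positive semidefiniteness for every `r`. -/
def IsCompletelyPositive {A B : Type*} (N : SuperOp A B) : Prop :=
  ∀ (r : ℕ) (X : Matrix (Fin r × A) (Fin r × A) ℂ), X.PosSemidef →
    (ampliate (Fin r) N X).PosSemidef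

/-- Preservation of the trace. -/
def IsTracePreserving {A B : Type*} [Fintype A] [Fintype B] (N : SuperOp A B) : Prop :=
  ∀ X : Matrix A A ℂ, (N X).trace = X.trace

/-- Quantum channels: completely positive trace-preserving maps. -/
def IsChannel {A B : Type*} [Fintype A] [Fintype B] (N : SuperOp A B) : Prop :=
  IsCompletelyPositive N ∧ IsTracePreserving N

/-- The maximally entangled unit vector `|A|^{-1/2} ∑ᵢ |ii⟩`. -/
def maxEntangledVec (A : Type*) [Fintype A] [DecidableEq A] : A × A → ℂ :=
  fun x => if x.1 = x.2 then ((Real.sqrt (Fintype.card A) : ℝ) : ℂ)⁻¹ else 0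

/-- The maximally entangled state, i.e. the projector onto `maxEntangledVec A`. -/
def maxEntangled (A : Type*) [Fintype A] [DecidableEq A] : Matrix (A × A) (A × A) ℂ :=
  Matrix.vecMulVec (maxEntangledVec A) (star (maxEntangledVec A))

/-- The Choi–Jamiołkowski state `(id ⊗ N)(Φ)` of `N`, with `Φ` the maximally entangled state. -/
def choiState {A B : Type*} [Fintype A] [DecidableEq A] (N : SuperOp A B) :
    Matrix (A × B) (A × B) ℂ :=
  ampliate A N (maxEntangled A)

/-- The tensor product `N₁ ⊗ N₂`. -/
def tensor {A₁ B₁ A₂ B₂ : Type*} [Fintype A₁] [DecidableEq A₁] [Fintype A₂] [DecidableEq A₂]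
    (N₁ : SuperOp A₁ B₁) (N₂ : SuperOp A₂ B₂) : SuperOp (A₁ × A₂) (B₁ × B₂) where
  toFun X := ∑ a : A₁ × A₂, ∑ a' : A₁ × A₂,
    X a a' • (N₁ (Matrix.single a.1 a'.1 1) ⊗ₖ N₂ (Matrix.single a.2 a'.2 1))
  map_add' X Y := by simp [add_smul, Finset.sum_add_distrib]
  map_smul' c X := by simp [mul_smul, Finset.smul_sum]

/-- The tensor power `N^{⊗ n}`, acting on `(ℂ^A)^{⊗ n}`, whose basis is indexed by `Fin n → A`. -/
def tensorPower {A B : Type*} [Fintype A] [DecidableEq A] (n : ℕ) (N : SuperOp A B) :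
    SuperOp (Fin n → A) (Fin n → B) where
  toFun X := ∑ a : Fin n → A, ∑ a' : Fin n → A,
    X a a' • Matrix.of fun b b' : Fin n → B => ∏ t, N (Matrix.single (a t) (a' t) 1) (b t) (b' t)
  map_add' X Y := by simp only [Matrix.add_apply, add_smul, Finset.sum_add_distrib]
  map_smul' c X := by
    simp only [Matrix.smul_apply, smul_eq_mul, mul_smul, Finset.smul_sum, RingHom.id_apply]

/-! ### Quantum capacity -/

/-- The entanglement fidelity `⟨Φ| (id ⊗ T)(|Φ⟩⟨Φ|) |Φ⟩` of `T` on the maximally mixed state. -/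
def entanglementFidelity {A : Type*} [Fintype A] [DecidableEq A] (T : SuperOp A A) : ℝ :=
  (star (maxEntangledVec A) ⬝ᵥ (choiState T).mulVec (maxEntangledVec A)).re

/-- `R` (qubits per channel use) is an achievable rate for `N`: for every `ε > 0` and all large `n`
there are an encoder and a decoder, both channels, that transmit one half of a maximally entangled
state of Schmidt rank `K ≥ 2^{n (R - ε)}` over `n` uses of `N` with fidelity at least `1 - ε`. -/
def IsAchievableRate {A B : Type*} [Fintype A] [DecidableEq A] [Fintype B]
    (N : SuperOp A B) (R : ℝ) : Prop :=
  ∀ ε : ℝ, 0 < ε → ∀ᶠ n : ℕ in Filter.atTop,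
    ∃ (K : ℕ) (E : SuperOp (Fin K) (Fin n → A)) (D : SuperOp (Fin n → B) (Fin K)),
      0 < K ∧ IsChannel E ∧ IsChannel D ∧
      n * (R - ε) ≤ Real.logb 2 K ∧
      1 - ε ≤ entanglementFidelity (D ∘ₗ tensorPower n N ∘ₗ E)

/-- The quantum capacity: the supremum of the achievable rates, in `[0, ∞]`. -/
def quantumCapacity {A B : Type*} [Fintype A] [DecidableEq A] [Fintype B]
    (N : SuperOp A B) : ℝ≥0∞ :=
  ⨆ (R : ℝ≥0) (_ : IsAchievableRate N R), (R : ℝ≥0∞)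

/-! ### Erasure -/

/-- An operator on `A`, extended by zero to `A ⊕ ℂ|e⟩`; the flag vector `|e⟩` is `none`. -/
def flagExtend {A : Type*} : Matrix A A ℂ →ₗ[ℂ] Matrix (Option A) (Option A) ℂ where
  toFun X := Matrix.of fun x y =>
    match x, y with
    | some a, some a' => X a a'
    | _, _ => 0
  map_add' X Y := by ext (_ | a) (_ | b) <;> simp
  map_smul' c X := by ext (_ | a) (_ | b) <;> simp

/-- The erasure flag `|e⟩⟨e|`. -/
def flag (A : Type*) [DecidableEq A] : Matrix (Option A) (Option A) ℂ :=
  Matrix.single none none 1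

/-- The erasure channel on `ℂ^A` with erasure probability `q`: `X ↦ (1 - q) X + q (Tr X) |e⟩⟨e|`. -/
def erasureChannel (A : Type*) [Fintype A] [DecidableEq A] (q : ℝ) : SuperOp A (Option A) :=
  ((1 - q : ℝ) : ℂ) • flagExtend + (q : ℂ) • (Matrix.traceLinearMap A ℂ ℂ).smulRight (flag A)

/-! ### The approximate private bit with positive partial transpose -/

/-- The Bell vectors `(|00⟩ ± |11⟩) / √2`, with sign `s`. -/
def bellVec (s : ℤˣ) : Fin 2 × Fin 2 → ℂ :=
  fun x => if x.1 = x.2 then (if x.1 = 0 then 1 else ((s : ℤ) : ℂ)) / ((Real.sqrt 2 : ℝ) : ℂ) else 0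

/-- The projector `Φ_±` onto a Bell vector. -/
def bell (s : ℤˣ) : Matrix (Fin 2 × Fin 2) (Fin 2 × Fin 2) ℂ :=
  Matrix.vecMulVec (bellVec s) (star (bellVec s))

/-- `(|01⟩⟨01| + |10⟩⟨10|) / 2`. -/
def omegaSep : Matrix (Fin 2 × Fin 2) (Fin 2 × Fin 2) ℂ :=
  (1 / 2 : ℂ) • (Matrix.single (0, 1) (0, 1) 1 + Matrix.single (1, 0) (1, 0) 1)

/-- The flip operator `|ij⟩ ↦ |ji⟩` on `ℂ^d ⊗ ℂ^d`. -/
def flipOp (d : ℕ) : Matrix (Fin d × Fin d) (Fin d × Fin d) ℂ :=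
  Matrix.of fun x y => if x.1 = y.2 ∧ x.2 = y.1 then 1 else 0

/-- The projector onto the symmetric subspace. -/
def symProj (d : ℕ) : Matrix (Fin d × Fin d) (Fin d × Fin d) ℂ := (1 / 2 : ℂ) • (1 + flipOp d)

/-- The projector onto the antisymmetric subspace. -/
def asymProj (d : ℕ) : Matrix (Fin d × Fin d) (Fin d × Fin d) ℂ := (1 / 2 : ℂ) • (1 - flipOp d)

/-- The normalized projector onto the symmetric subspace. -/
def rhoSym (d : ℕ) : Matrix (Fin d × Fin d) (Fin d × Fin d) ℂ :=
  (2 / ((d : ℂ) ^ 2 + d)) • symProj d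

/-- The normalized projector onto the antisymmetric subspace. -/
def rhoAsym (d : ℕ) : Matrix (Fin d × Fin d) (Fin d × Fin d) ℂ :=
  (2 / ((d : ℂ) ^ 2 - d)) • asymProj d

/-- The tensor power `ρ^{⊗ m}` of a bipartite operator, with the `m` first factors and the `m`
second factors collected into one system each. -/
def bipartitePower {A B : Type*} (m : ℕ) (ρ : Matrix (A × B) (A × B) ℂ) :
    Matrix ((Fin m → A) × (Fin m → B)) ((Fin m → A) × (Fin m → B)) ℂ :=
  Matrix.of fun x y => ∏ t, ρ (x.1 t, x.2 t) (y.1 t, y.2 t)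

/-- The hiding state `((ρ_s + ρ_a) / 2)^{⊗ m}`. -/
def tau1 (d m : ℕ) := bipartitePower m ((1 / 2 : ℂ) • (rhoSym d + rhoAsym d))

/-- The hiding state `ρ_s^{⊗ m}`. -/
def tau2 (d m : ℕ) := bipartitePower m (rhoSym d)

/-- The system held by each party: a key qubit and a shield of `m` systems of dimension `d`. -/
abbrev KeyShield (d m : ℕ) := Fin 2 × (Fin m → Fin d)

/-- The product of an operator on `A B` and one on `A' B'`, as an operator on `(A A')(B B')`. -/
def regroup {A B A' B' : Type*} (X : Matrix (A × B) (A × B) ℂ)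
    (Y : Matrix (A' × B') (A' × B') ℂ) : Matrix ((A × A') × (B × B')) ((A × A') × (B × B')) ℂ :=
  (X ⊗ₖ Y).submatrix (Equiv.prodProdProdComm A A' B B') (Equiv.prodProdProdComm A A' B B')

/-- The state
`γ_± = (p/2) (Φ_± ⊗ τ₁ + Φ_∓ ⊗ τ₂) + (1 - p) ω_sep ⊗ τ₂`, with sign `s`. -/
def gammaState (s : ℤˣ) (p : ℝ) (d m : ℕ) :
    Matrix (KeyShield d m × KeyShield d m) (KeyShield d m × KeyShield d m) ℂ :=
  ((p / 2 : ℝ) : ℂ) • (regroup (bell s) (tau1 d m) + regroup (bell (-s)) (tau2 d m)) +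
    ((1 - p : ℝ) : ℂ) • regroup omegaSep (tau2 d m)

/-- An operator on `A B`, extended by zero to `A (B ⊕ ℂ|e⟩)`. -/
def flagExtendRight {A B : Type*} (X : Matrix (A × B) (A × B) ℂ) :
    Matrix (A × Option B) (A × Option B) ℂ :=
  Matrix.of fun x y =>
    match x.2, y.2 with
    | some b, some b' => X (x.1, b) (y.1, b')
    | _, _ => 0

/-- The `k`-hybrid state `(1/k) γ + ((k-1)/k) (𝟙/|A|) ⊗ |e⟩⟨e|` built from a state `γ` on `A B`. -/
def hybridState {A B : Type*} [Fintype A] [DecidableEq A] [DecidableEq B] (k : ℕ)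
    (γ : Matrix (A × B) (A × B) ℂ) : Matrix (A × Option B) (A × Option B) ℂ :=
  (1 / k : ℂ) • flagExtendRight γ +
    (((k : ℂ) - 1) / k) • (((Fintype.card A : ℂ)⁻¹ • (1 : Matrix A A ℂ)) ⊗ₖ flag B)

end QuantumChannel

end

/-!
Two classes of channels have no quantum capacity for elementary reasons, and the hybrid channel lies
in both.

A channel whose Choi state has positive partial transpose stays in that class under tensor products
and under encoding and decoding by arbitrary channels. The partial transpose of the maximally
entangled projector of rank `K` is the flip divided by `K`, so a code of rank `K` over such a channel
has fidelity at most `1 / K` (`IsPPT.entanglementFidelity_le`).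

A two-extendible channel is one whose output can be broadcast to two receivers each of whom sees the
channel. This class too is closed under tensor products, encoding and decoding. Monogamy bounds the
fidelity by `(1 + 1 / K) / 2` (`IsTwoExtendible.entanglementFidelity_le`): the two projectors that
test whether the sender is maximally entangled with the first or with the second receiver add up to
at most `1 + 1 / K`, the gap being a sum of squares (`posSemidef_sub_add_of_overlap`). Both bounds are at most `3 / 4` for `K ≥ 2`, while a positive rate
would force ranks `K ≥ 2` with fidelity close to one (`quantumCapacity_eq_zero`).

The hybrid channel is the channel of `γ_+` followed by an erasure of probability `1 - 1 / k ≥ 1 / 2`.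
An erasure of probability at least one half makes any channel two-extendible
(`isTwoExtendible_erase`), since the output can be given to either receiver with equal probability;
this covers the product with an erasure channel. Erasure also preserves positive partial transpose
(`isPPT_erase`), which covers the product with the channel of `γ_±`, once `γ_±` is known to have
positive partial transpose. Its partial transpose is block diagonal in the key, and admissibility
makes each block nonnegative (`posSemidef_partialTranspose_gammaState`): on one shield factor the
partial transpose of `(ρ_s + ρ_a) / 2` is at most `d / (d - 1)` times that of `ρ_s`, and this
inequality is raised to the `m`-th tensor power.

Complete positivity is handled through Choi matrices. All tensor products are entrywise products of
reindexed matrices, so that the Schur product theorem gives their positivity.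
-/

noncomputable section

namespace QuantumChannel

/-! ### Positive semidefinite matrices -/

/-- Summing a positive semidefinite matrix over all entries of a tensor factor, i.e. compressing it
by the vector `∑ₖ |k⟩` of that factor, leaves it positive semidefinite. -/
theorem posSemidef_sum_sum {ι κ : Type*} [Fintype ι] [Fintype κ]
    {M : Matrix (ι × κ) (ι × κ) ℂ} (hM : M.PosSemidef) :
    (Matrix.of fun i j => ∑ k, ∑ l, M (i, k) (j, l)).PosSemidef := by
  classical
  let B : Matrix (ι × κ) ι ℂ := Matrix.of fun x j => if x.1 = j then 1 else 0
  convert hM.conjTranspose_mul_mul_same B using 1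
  ext i j
  simp only [B, Matrix.mul_apply, Matrix.conjTranspose_apply, Matrix.of_apply,
    Fintype.sum_prod_type]
  simp only [apply_ite star, star_one, star_zero, ite_mul, one_mul, zero_mul, mul_ite, mul_one,
    mul_zero, Finset.sum_const_zero, Finset.sum_ite_irrel, Finset.sum_ite_eq', Finset.mem_univ,
    if_true]
  exact Finset.sum_comm

/-- The real part of an off-diagonal entry is at most the mean of the diagonal ones. -/
theorem re_apply_le_of_posSemidef {ι : Type*} {M : Matrix ι ι ℂ}
    (hM : M.PosSemidef) (x y : ι) : (M x y).re ≤ ((M x x).re + (M y y).re) / 2 := by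
  have h := (hM.submatrix ![x, y]).dotProduct_mulVec_nonneg ![1, -1]
  have hh : M y x = star (M x y) := (hM.isHermitian.apply y x).symm
  have h2 := (Complex.le_def.mp h).1
  simp [Matrix.mulVec, dotProduct, Fin.sum_univ_two, hh] at h2
  linarith

/-- The Schur product theorem. -/
theorem posSemidef_mul_apply {ι : Type*} {M N : Matrix ι ι ℂ} (hM : M.PosSemidef)
    (hN : N.PosSemidef) : (Matrix.of fun x y => M x y * N x y).PosSemidef :=
  hM.hadamard hN

/-- A product of positive semidefinite matrices, entry by entry, is positive semidefinite. -/
theorem posSemidef_prod {ι κ : Type*} [Fintype ι] {M : κ → Matrix ι ι ℂ} (s : Finset κ)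
    (hM : ∀ t ∈ s, (M t).PosSemidef) : (Matrix.of fun x y => ∏ t ∈ s, M t x y).PosSemidef := by
  classical
  induction s using Finset.induction_on with
  | empty =>
    convert Matrix.posSemidef_vecMulVec_self_star (fun _ : ι => (1 : ℂ)) using 1
    ext; simp [Matrix.vecMulVec]
  | insert a s ha ih =>
    have h := posSemidef_mul_apply (hM a (by simp)) (ih fun t ht => hM t (by simp [ht]))
    simpa [Finset.prod_insert ha] using h

/-- Entrywise products are monotone for the Loewner order on positive semidefinite matrices. -/
theorem posSemidef_prod_sub_prod {ι κ : Type*} [Fintype ι] {M N : κ → Matrix ι ι ℂ}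
    (s : Finset κ) (hM : ∀ t ∈ s, (M t).PosSemidef) (hMN : ∀ t ∈ s, (N t - M t).PosSemidef) :
    (Matrix.of fun x y => ∏ t ∈ s, N t x y - ∏ t ∈ s, M t x y).PosSemidef := by
  classical
  induction s using Finset.induction_on with
  | empty => convert Matrix.PosSemidef.zero (n := ι) (R := ℂ) using 1; ext; simp
  | insert a s ha ih =>
    have hMs : ∀ t ∈ s, (M t).PosSemidef := fun t ht => hM t (by simp [ht])
    have hN : (N a).PosSemidef := by
      simpa using (hMN a (by simp)).add (hM a (by simp))
    have h := (posSemidef_mul_apply (hMN a (by simp)) (posSemidef_prod s hMs)).add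
      (posSemidef_mul_apply hN (ih hMs fun t ht => hMN t (by simp [ht])))
    convert h using 1
    ext x y
    simp only [Finset.prod_insert ha, Matrix.of_apply, Matrix.add_apply,
      Matrix.sub_apply]
    ring

theorem re_trace_mul_nonneg {ι : Type*} [Fintype ι] {J Q : Matrix ι ι ℂ}
    (hJ : J.PosSemidef) (hQ : Q.PosSemidef) : 0 ≤ (J * Q).trace.re := by
  -- the trace is the sum of all entries of the Schur product of `J` and `Qᵀ`
  have h := (posSemidef_mul_apply hJ hQ.transpose).dotProduct_mulVec_nonneg 1
  have e : (J * Q).trace =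
      star 1 ⬝ᵥ (Matrix.of fun x y => J x y * Q.transpose x y).mulVec 1 := by
    simp [Matrix.trace, Matrix.mul_apply, dotProduct, Matrix.mulVec]
  rw [e]
  exact (Complex.le_def.mp h).1

/-! ### Composition -/

section Comp

variable {A B C : Type*}

theorem IsCompletelyPositive.comp {N : SuperOp A B} {M : SuperOp B C}
    (hM : IsCompletelyPositive M) (hN : IsCompletelyPositive N) :
    IsCompletelyPositive (M ∘ₗ N) := fun r X hX => hM r _ (hN r X hX)

variable [Fintype A] [Fintype B] [Fintype C]

theorem IsTracePreserving.comp {N : SuperOp A B} {M : SuperOp B C}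
    (hM : IsTracePreserving M) (hN : IsTracePreserving N) :
    IsTracePreserving (M ∘ₗ N) := fun X => (hM _).trans (hN X)

theorem IsChannel.comp {N : SuperOp A B} {M : SuperOp B C} (hM : IsChannel M)
    (hN : IsChannel N) : IsChannel (M ∘ₗ N) := ⟨hM.1.comp hN.1, hM.2.comp hN.2⟩

end Comp

/-! ### Choi matrices -/

/-- The Choi matrix `∑ |a⟩⟨a'| ⊗ N(|a⟩⟨a'|)`, without the normalization of `choiState`. -/
def choi {A B : Type*} [DecidableEq A] (N : SuperOp A B) : Matrix (A × B) (A × B) ℂ :=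
  Matrix.of fun x y => N (Matrix.single x.1 y.1 1) x.2 y.2

/-- The linear map with a given Choi matrix. -/
def ofChoi {A B : Type*} [Fintype A] (J : Matrix (A × B) (A × B) ℂ) : SuperOp A B where
  toFun X := Matrix.of fun b b' => ∑ a, ∑ a', X a a' * J (a, b) (a', b')
  map_add' X Y := by ext; simp [add_mul, Finset.sum_add_distrib]
  map_smul' c X := by ext; simp [mul_assoc, Finset.mul_sum]

section Choi

variable {A B C : Type*} [Fintype A] [DecidableEq A]

theorem apply_eq_sum_choi (N : SuperOp A B) (X : Matrix A A ℂ) (b b' : B) :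
    N X b b' = ∑ a, ∑ a', X a a' * choi N (a, b) (a', b') := by
  conv_lhs => rw [Matrix.matrix_eq_sum_single X]
  simp only [map_sum, Matrix.sum_apply, choi, Matrix.of_apply]
  refine Finset.sum_congr rfl fun a _ => Finset.sum_congr rfl fun a' _ => ?_
  rw [← mul_one (X a a'), ← smul_eq_mul, ← Matrix.smul_single, map_smul]
  simp

theorem choi_injective : Function.Injective (choi : SuperOp A B → _) := by
  intro N M h
  ext X b b'
  rw [apply_eq_sum_choi, apply_eq_sum_choi, h]

@[simp]
theorem choi_ofChoi (J : Matrix (A × B) (A × B) ℂ) : choi (ofChoi J) = J := by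
  ext ⟨a, b⟩ ⟨a', b'⟩
  simp [choi, ofChoi, Matrix.single_apply, ite_and]

theorem inv_sqrt_mul_inv_sqrt (n : ℕ) :
    ((Real.sqrt n : ℝ) : ℂ)⁻¹ * ((Real.sqrt n : ℝ) : ℂ)⁻¹ = (n : ℂ)⁻¹ := by
  rw [← mul_inv, ← Complex.ofReal_mul, Real.mul_self_sqrt (Nat.cast_nonneg _)]
  simp

theorem choiState_eq (N : SuperOp A B) :
    choiState N = (Fintype.card A : ℂ)⁻¹ • choi N := by
  ext ⟨a, b⟩ ⟨a', b'⟩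
  have h : (Matrix.of fun i j => maxEntangled A (a, i) (a', j)) =
      (Fintype.card A : ℂ)⁻¹ • Matrix.single a a' (1 : ℂ) := by
    ext i j
    simp only [maxEntangled, Matrix.vecMulVec_apply, maxEntangledVec, Matrix.of_apply,
      Pi.star_apply, Matrix.smul_apply, Matrix.single_apply, smul_eq_mul]
    by_cases h1 : a = i <;> by_cases h2 : a' = j <;>
      simp [h1, h2, ← inv_sqrt_mul_inv_sqrt]
  simp only [choiState, ampliate, Matrix.of_apply, h, map_smul, Matrix.smul_apply, choi]

/-- A map is determined by its Choi state. -/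
theorem choi_eq_of_choiState_eq [Nonempty A] {N : SuperOp A B} {ρ : Matrix (A × B) (A × B) ℂ}
    (h : choiState N = ρ) : choi N = (Fintype.card A : ℂ) • ρ := by
  rw [← h, choiState_eq, smul_smul, mul_inv_cancel₀ (by simp), one_smul]

variable [Fintype B] [Fintype C]

theorem posSemidef_ampliate {R : Type*} [Fintype R] {N : SuperOp A B} (hN : (choi N).PosSemidef)
    {X : Matrix (R × A) (R × A) ℂ} (hX : X.PosSemidef) : (ampliate R N X).PosSemidef := by
  have h := posSemidef_sum_sum (posSemidef_mul_apply
    (hX.submatrix fun z : (R × B) × A => (z.1.1, z.2))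
    (hN.submatrix fun z : (R × B) × A => (z.2, z.1.2)))
  convert h using 1
  ext ⟨r, b⟩ ⟨r', b'⟩
  simp [ampliate, apply_eq_sum_choi N]

/-- Choi's theorem. -/
theorem isCompletelyPositive_iff {N : SuperOp A B} :
    IsCompletelyPositive N ↔ (choi N).PosSemidef := by
  refine ⟨fun h => ?_, fun h r X hX => posSemidef_ampliate h hX⟩
  let e := Fintype.equivFin A
  have hv := Matrix.posSemidef_vecMulVec_self_star
    (fun x : Fin (Fintype.card A) × A => if x.1 = e x.2 then (1 : ℂ) else 0)
  convert (h _ _ hv).submatrix (fun x : A × B => (e x.1, x.2)) using 1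
  ext ⟨a, b⟩ ⟨a', b'⟩
  have hs : Matrix.single a a' (1 : ℂ) = Matrix.of fun i j => Matrix.vecMulVec
      (fun x : Fin (Fintype.card A) × A => if x.1 = e x.2 then (1 : ℂ) else 0)
      (star fun x : Fin (Fintype.card A) × A => if x.1 = e x.2 then (1 : ℂ) else 0)
      (e a, i) (e a', j) := by
    ext i j
    by_cases h1 : a = i <;> by_cases h2 : a' = j <;>
      simp [Matrix.vecMulVec_apply, h1, h2]
  simp only [choi, ampliate, Matrix.of_apply, Matrix.submatrix_apply, hs]

theorem isTracePreserving_iff {N : SuperOp A B} :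
    IsTracePreserving N ↔ ∀ a a', ∑ b, choi N (a, b) (a', b) = if a = a' then 1 else 0 := by
  constructor
  · intro h a a'
    have := h (Matrix.single a a' 1)
    simp only [Matrix.trace, Matrix.diag_apply] at this
    simp only [choi, Matrix.of_apply, this, Matrix.single_apply]
    simp [ite_and, eq_comm]
  · intro h X
    simp only [Matrix.trace, Matrix.diag_apply, apply_eq_sum_choi N]
    rw [Finset.sum_comm]
    refine Finset.sum_congr rfl fun a _ => ?_
    rw [Finset.sum_comm]
    simp [← Finset.mul_sum, h]

end Choi

/-! ### Tensor products -/

section Tensor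

variable {A₁ B₁ A₂ B₂ A B : Type*} [Fintype A₁] [DecidableEq A₁] [Fintype A₂] [DecidableEq A₂]
  [Fintype A] [DecidableEq A]

theorem choi_tensor (N₁ : SuperOp A₁ B₁) (N₂ : SuperOp A₂ B₂) (x y : (A₁ × A₂) × (B₁ × B₂)) :
    choi (tensor N₁ N₂) x y = choi N₁ (x.1.1, x.2.1) (y.1.1, y.2.1) *
      choi N₂ (x.1.2, x.2.2) (y.1.2, y.2.2) := by
  simp only [choi, tensor, Matrix.of_apply, LinearMap.coe_mk, AddHom.coe_mk, Matrix.sum_apply,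
    Matrix.smul_apply, Matrix.single_apply, ite_and, Matrix.kroneckerMap_apply, smul_eq_mul]
  simp

theorem choi_tensorPower (n : ℕ) (N : SuperOp A B) (x y : (Fin n → A) × (Fin n → B)) :
    choi (tensorPower n N) x y = ∏ t, choi N (x.1 t, x.2 t) (y.1 t, y.2 t) := by
  simp only [choi, tensorPower, Matrix.of_apply, LinearMap.coe_mk, AddHom.coe_mk,
    Matrix.sum_apply, Matrix.smul_apply, Matrix.single_apply, ite_and, smul_eq_mul]
  simp

variable [Fintype B₁] [Fintype B₂] [Fintype B]

theorem IsCompletelyPositive.tensor {N₁ : SuperOp A₁ B₁} {N₂ : SuperOp A₂ B₂}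
    (h₁ : IsCompletelyPositive N₁) (h₂ : IsCompletelyPositive N₂) :
    IsCompletelyPositive (tensor N₁ N₂) := by
  rw [isCompletelyPositive_iff] at *
  convert posSemidef_mul_apply
    (h₁.submatrix fun x : (A₁ × A₂) × (B₁ × B₂) => (x.1.1, x.2.1))
    (h₂.submatrix fun x : (A₁ × A₂) × (B₁ × B₂) => (x.1.2, x.2.2)) using 1
  ext x y
  simp [choi_tensor]

theorem IsCompletelyPositive.tensorPower (n : ℕ) {N : SuperOp A B}
    (h : IsCompletelyPositive N) : IsCompletelyPositive (tensorPower n N) := by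
  rw [isCompletelyPositive_iff] at *
  convert posSemidef_prod Finset.univ fun t _ =>
    h.submatrix fun x : (Fin n → A) × (Fin n → B) => (x.1 t, x.2 t) using 1
  ext x y
  simp [choi_tensorPower]

theorem IsTracePreserving.tensor {N₁ : SuperOp A₁ B₁} {N₂ : SuperOp A₂ B₂}
    (h₁ : IsTracePreserving N₁) (h₂ : IsTracePreserving N₂) :
    IsTracePreserving (tensor N₁ N₂) := by
  rw [isTracePreserving_iff] at *
  rintro ⟨a, c⟩ ⟨a', c'⟩
  simp only [choi_tensor, Fintype.sum_prod_type, ← Finset.mul_sum, ← Finset.sum_mul, h₁, h₂,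
    Prod.mk.injEq, ite_and, ite_mul, one_mul, zero_mul]

theorem IsTracePreserving.tensorPower (n : ℕ) {N : SuperOp A B}
    (h : IsTracePreserving N) : IsTracePreserving (tensorPower n N) := by
  rw [isTracePreserving_iff] at *
  intro a a'
  simp only [choi_tensorPower]
  rw [← Fintype.piFinset_univ, ← Finset.prod_univ_sum (fun _ => Finset.univ)
    (fun t b => choi N (a t, b) (a' t, b))]
  simp only [h, Finset.prod_ite_zero, Finset.prod_const_one, Finset.mem_univ, true_imp_iff,
    funext_iff]

theorem IsChannel.tensor {N₁ : SuperOp A₁ B₁} {N₂ : SuperOp A₂ B₂} (h₁ : IsChannel N₁)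
    (h₂ : IsChannel N₂) : IsChannel (tensor N₁ N₂) := ⟨h₁.1.tensor h₂.1, h₁.2.tensor h₂.2⟩

theorem IsChannel.tensorPower (n : ℕ) {N : SuperOp A B} (h : IsChannel N) :
    IsChannel (tensorPower n N) := ⟨h.1.tensorPower n, h.2.tensorPower n⟩

end Tensor

/-! ### Channels with positive partial transpose -/

section PPT

variable {A B C : Type*}

/-- The transpose map `X ↦ Xᵀ`. -/
def transposeOp (A : Type*) : SuperOp A A :=
  (Matrix.transposeLinearEquiv A A ℂ ℂ).toLinearMap

@[simp]
theorem transposeOp_apply (X : Matrix A A ℂ) : transposeOp A X = X.transpose := rfl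

/-- Channels whose Choi state has positive partial transpose, expressed as complete positivity of
the channel followed by the transpose. -/
structure IsPPT [Fintype A] [Fintype B] (N : SuperOp A B) : Prop where
  isChannel : IsChannel N
  transpose : IsCompletelyPositive (transposeOp B ∘ₗ N)

/-- Conjugating a completely positive map by the transpose amounts, after ampliation, to
conjugating by the transpose of the whole system, which preserves positivity. -/
theorem IsCompletelyPositive.conj_transposeOp {N : SuperOp A B} (h : IsCompletelyPositive N) :
    IsCompletelyPositive (transposeOp B ∘ₗ N ∘ₗ transposeOp A) :=
  fun r _ hX => (h r _ hX.transpose).transpose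

theorem transposeOp_comp_transposeOp : transposeOp A ∘ₗ transposeOp A = LinearMap.id := by
  ext; simp

theorem choi_transposeOp_comp [DecidableEq A] (N : SuperOp A B) (x y : A × B) :
    choi (transposeOp B ∘ₗ N) x y = choi N (x.1, y.2) (y.1, x.2) := rfl

variable [Fintype A] [Fintype B] [Fintype C]

theorem IsPPT.comp_right {N : SuperOp B C} (hN : IsPPT N) {E : SuperOp A B} (hE : IsChannel E) :
    IsPPT (N ∘ₗ E) :=
  ⟨hN.1.comp hE, hN.2.comp hE.1⟩

theorem IsPPT.comp_left {N : SuperOp A B} (hN : IsPPT N) {D : SuperOp B C} (hD : IsChannel D) :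
    IsPPT (D ∘ₗ N) := by
  refine ⟨hD.comp hN.1, ?_⟩
  have h := hD.1.conj_transposeOp.comp hN.2
  rwa [LinearMap.comp_assoc, LinearMap.comp_assoc, ← LinearMap.comp_assoc N,
    transposeOp_comp_transposeOp, LinearMap.id_comp] at h

variable [DecidableEq A]

theorem IsPPT.tensorPower (n : ℕ) {N : SuperOp A B} (h : IsPPT N) :
    IsPPT (tensorPower n N) := by
  refine ⟨h.1.tensorPower n, ?_⟩
  convert h.2.tensorPower n using 1
  apply choi_injective
  ext x y
  simp only [choi_transposeOp_comp, choi_tensorPower]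

theorem IsPPT.tensor {A' B' : Type*} [Fintype A'] [DecidableEq A'] [Fintype B']
    {N : SuperOp A B} {N' : SuperOp A' B'} (h : IsPPT N) (h' : IsPPT N') :
    IsPPT (tensor N N') := by
  refine ⟨h.1.tensor h'.1, ?_⟩
  convert h.2.tensor h'.2 using 1
  apply choi_injective
  ext x y
  simp only [choi_transposeOp_comp, choi_tensor]

end PPT

/-! ### Two-extendible channels -/

section TwoExtendible

variable {A B C : Type*}

/-- The partial trace over the second factor. -/
def traceRight (B C : Type*) [Fintype C] : SuperOp (B × C) B where
  toFun X := Matrix.of fun b b' => ∑ c, X (b, c) (b', c)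
  map_add' X Y := by ext; simp [Finset.sum_add_distrib]
  map_smul' c X := by ext; simp [Finset.mul_sum]

/-- The partial trace over the first factor. -/
def traceLeft (B C : Type*) [Fintype B] : SuperOp (B × C) C where
  toFun X := Matrix.of fun c c' => ∑ b, X (b, c) (b, c')
  map_add' X Y := by ext; simp [Finset.sum_add_distrib]
  map_smul' c X := by ext; simp [Finset.mul_sum]

/-- Two-extendible (antidegradable) channels: some completely positive map broadcasts the output of
the channel to two receivers, each of whom sees the channel. -/
structure IsTwoExtendible [Fintype A] [Fintype B] (N : SuperOp A B) : Prop where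
  isChannel : IsChannel N
  exists_extension : ∃ M : SuperOp A (B × B), IsCompletelyPositive M ∧
    traceRight B B ∘ₗ M = N ∧ traceLeft B B ∘ₗ M = N

theorem choi_traceRight_comp [DecidableEq A] [Fintype C] (M : SuperOp A (B × C)) (x y : A × B) :
    choi (traceRight B C ∘ₗ M) x y = ∑ c, choi M (x.1, x.2, c) (y.1, y.2, c) := rfl

theorem choi_traceLeft_comp [DecidableEq A] [Fintype B] (M : SuperOp A (B × C)) (x y : A × C) :
    choi (traceLeft B C ∘ₗ M) x y = ∑ b, choi M (x.1, b, x.2) (y.1, b, y.2) := rfl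

variable [Fintype A] [Fintype B] [Fintype C]

theorem IsTwoExtendible.comp_right {N : SuperOp B C} (hN : IsTwoExtendible N) {E : SuperOp A B}
    (hE : IsChannel E) : IsTwoExtendible (N ∘ₗ E) := by
  obtain ⟨h, M, hM, h₁, h₂⟩ := hN
  exact ⟨h.comp hE, M ∘ₗ E, hM.comp hE.1, by rw [← LinearMap.comp_assoc, h₁],
    by rw [← LinearMap.comp_assoc, h₂]⟩

/-- Discarding one of two receivers who decode separately is discarding before decoding. -/
theorem traceRight_comp_tensor [DecidableEq B] {D : SuperOp B C} (hD : IsTracePreserving D) :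
    traceRight C C ∘ₗ tensor D D = D ∘ₗ traceRight B B := by
  rw [isTracePreserving_iff] at hD
  apply choi_injective
  ext ⟨⟨a, b⟩, c⟩ ⟨⟨a', b'⟩, c'⟩
  rw [choi_traceRight_comp]
  simp only [choi_tensor, ← Finset.mul_sum, hD]
  have h : traceRight B B (Matrix.single (a, b) (a', b') 1) =
      (if b = b' then (1 : ℂ) else 0) • Matrix.single a a' 1 := by
    ext i j
    simp only [traceRight, LinearMap.coe_mk, AddHom.coe_mk, Matrix.of_apply, Matrix.single_apply,
      Prod.mk.injEq, Matrix.smul_apply, smul_eq_mul]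
    by_cases hb : b = b'
    · simp [hb, ite_and]
    · simp only [hb, if_false, zero_mul]
      exact Finset.sum_eq_zero fun x _ => if_neg fun h => hb (h.1.2.trans h.2.2.symm)
  simp only [choi, Matrix.of_apply, LinearMap.comp_apply, h, map_smul, Matrix.smul_apply,
    smul_eq_mul]
  ring

theorem traceLeft_comp_tensor [DecidableEq B] {D : SuperOp B C} (hD : IsTracePreserving D) :
    traceLeft C C ∘ₗ tensor D D = D ∘ₗ traceLeft B B := by
  rw [isTracePreserving_iff] at hD
  apply choi_injective
  ext ⟨⟨a, b⟩, c⟩ ⟨⟨a', b'⟩, c'⟩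
  rw [choi_traceLeft_comp]
  simp only [choi_tensor, ← Finset.sum_mul, hD]
  have h : traceLeft B B (Matrix.single (a, b) (a', b') 1) =
      (if a = a' then (1 : ℂ) else 0) • Matrix.single b b' 1 := by
    ext i j
    simp only [traceLeft, LinearMap.coe_mk, AddHom.coe_mk, Matrix.of_apply, Matrix.single_apply,
      Prod.mk.injEq, Matrix.smul_apply, smul_eq_mul]
    by_cases ha : a = a'
    · simp [ha, ite_and]
    · simp only [ha, if_false, zero_mul]
      exact Finset.sum_eq_zero fun x _ => if_neg fun h => ha (h.1.1.trans h.2.1.symm)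
  simp only [choi, Matrix.of_apply, LinearMap.comp_apply, h, map_smul, Matrix.smul_apply,
    smul_eq_mul]

theorem IsTwoExtendible.comp_left [DecidableEq B] {N : SuperOp A B} (hN : IsTwoExtendible N)
    {D : SuperOp B C} (hD : IsChannel D) : IsTwoExtendible (D ∘ₗ N) := by
  obtain ⟨h, M, hM, h₁, h₂⟩ := hN
  refine ⟨hD.comp h, QuantumChannel.tensor D D ∘ₗ M, (hD.1.tensor hD.1).comp hM, ?_, ?_⟩
  · rw [← LinearMap.comp_assoc, traceRight_comp_tensor hD.2, LinearMap.comp_assoc, h₁]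
  · rw [← LinearMap.comp_assoc, traceLeft_comp_tensor hD.2, LinearMap.comp_assoc, h₂]

variable [DecidableEq A]

/-- Two-extendibility in terms of a tripartite operator whose two marginals are the Choi matrix. -/
theorem isTwoExtendible_iff_choi {N : SuperOp A B} (hN : IsChannel N) :
    IsTwoExtendible N ↔ ∃ J : Matrix (A × B × B) (A × B × B) ℂ, J.PosSemidef ∧
      (∀ a b a' b', ∑ c, J (a, b, c) (a', b', c) = choi N (a, b) (a', b')) ∧
      ∀ a b a' b', ∑ c, J (a, c, b) (a', c, b') = choi N (a, b) (a', b') := by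
  constructor
  · rintro ⟨-, M, hM, h₁, h₂⟩
    refine ⟨choi M, isCompletelyPositive_iff.mp hM, fun a b a' b' => ?_, fun a b a' b' => ?_⟩
    · rw [← h₁, choi_traceRight_comp]
    · rw [← h₂, choi_traceLeft_comp]
  · rintro ⟨J, hJ, h₁, h₂⟩
    refine ⟨hN, ofChoi J, by rwa [isCompletelyPositive_iff, choi_ofChoi], ?_, ?_⟩
    · apply choi_injective
      ext ⟨a, b⟩ ⟨a', b'⟩
      rw [choi_traceRight_comp, choi_ofChoi, h₁]
    · apply choi_injective
      ext ⟨a, b⟩ ⟨a', b'⟩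
      rw [choi_traceLeft_comp, choi_ofChoi, h₂]

theorem IsTwoExtendible.tensorPower (n : ℕ) {N : SuperOp A B} (h : IsTwoExtendible N) :
    IsTwoExtendible (tensorPower n N) := by
  obtain ⟨J, hJ, h₁, h₂⟩ := (isTwoExtendible_iff_choi h.1).mp h
  refine (isTwoExtendible_iff_choi (h.1.tensorPower n)).mpr ⟨Matrix.of fun x y =>
    ∏ t, J (x.1 t, x.2.1 t, x.2.2 t) (y.1 t, y.2.1 t, y.2.2 t), ?_, ?_, ?_⟩
  · exact posSemidef_prod Finset.univ fun t _ => hJ.submatrix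
      fun x : (Fin n → A) × (Fin n → B) × (Fin n → B) => (x.1 t, x.2.1 t, x.2.2 t)
  · intro a b a' b'
    simp only [choi_tensorPower, Matrix.of_apply, ← h₁]
    rw [Finset.prod_univ_sum, Fintype.piFinset_univ]
  · intro a b a' b'
    simp only [choi_tensorPower, Matrix.of_apply, ← h₂]
    rw [Finset.prod_univ_sum, Fintype.piFinset_univ]

theorem IsTwoExtendible.tensor {A' B' : Type*} [Fintype A'] [DecidableEq A'] [Fintype B']
    {N : SuperOp A B} {N' : SuperOp A' B'} (h : IsTwoExtendible N)
    (h' : IsTwoExtendible N') : IsTwoExtendible (tensor N N') := by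
  obtain ⟨J, hJ, h₁, h₂⟩ := (isTwoExtendible_iff_choi h.1).mp h
  obtain ⟨J', hJ', h₁', h₂'⟩ := (isTwoExtendible_iff_choi h'.1).mp h'
  refine (isTwoExtendible_iff_choi (h.1.tensor h'.1)).mpr ⟨Matrix.of fun x y =>
    J (x.1.1, x.2.1.1, x.2.2.1) (y.1.1, y.2.1.1, y.2.2.1) *
      J' (x.1.2, x.2.1.2, x.2.2.2) (y.1.2, y.2.1.2, y.2.2.2), ?_, ?_, ?_⟩
  · exact posSemidef_mul_apply
      (hJ.submatrix fun x : (A × A') × (B × B') × (B × B') => (x.1.1, x.2.1.1, x.2.2.1))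
      (hJ'.submatrix fun x : (A × A') × (B × B') × (B × B') => (x.1.2, x.2.1.2, x.2.2.2))
  · intro a b a' b'
    simp only [choi_tensor, Matrix.of_apply, ← h₁, ← h₁', Fintype.sum_prod_type,
      Finset.sum_mul_sum]
  · intro a b a' b'
    simp only [choi_tensor, Matrix.of_apply, ← h₂, ← h₂', Fintype.sum_prod_type,
      Finset.sum_mul_sum]

end TwoExtendible

/-! ### Entanglement fidelity -/

section Fidelity

variable {A : Type*} [Fintype A] [DecidableEq A]

theorem entanglementFidelity_eq (T : SuperOp A A) :
    entanglementFidelity T =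
      (∑ i, ∑ j, choi T (i, i) (j, j)).re / (Fintype.card A : ℝ) ^ 2 := by
  have h : star (maxEntangledVec A) ⬝ᵥ (choiState T).mulVec (maxEntangledVec A) =
      (((Fintype.card A : ℝ) ^ 2)⁻¹ : ℝ) * ∑ i, ∑ j, choi T (i, i) (j, j) := by
    push_cast
    rw [pow_two, mul_inv]
    nth_rw 1 [← inv_sqrt_mul_inv_sqrt]
    simp only [choiState_eq, dotProduct, Matrix.mulVec, Fintype.sum_prod_type, maxEntangledVec,
      Pi.star_apply, Matrix.smul_apply, smul_eq_mul, apply_ite star, star_zero, ite_mul, zero_mul,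
      mul_ite, mul_zero, Finset.sum_ite_irrel, Finset.sum_const_zero, Finset.sum_ite_eq,
      Finset.mem_univ, if_true, Finset.mul_sum]
    refine Finset.sum_congr rfl fun i _ => Finset.sum_congr rfl fun j _ => ?_
    simp only [star_inv₀, Complex.star_def, Complex.conj_ofReal]
    ring
  rw [entanglementFidelity, h, Complex.re_ofReal_mul, div_eq_inv_mul]

theorem sum_choi_diag {B : Type*} [Fintype B] {T : SuperOp A B} (hT : IsTracePreserving T) :
    ∑ i, ∑ j, choi T (i, j) (i, j) = Fintype.card A := by
  rw [isTracePreserving_iff] at hT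
  simp [hT]

/-- A channel with positive partial transpose has the fidelity of a separable state: the partial
transpose turns `Φ` into `1 / |A|` times the flip, whose expectation is at most one. -/
theorem IsPPT.entanglementFidelity_le {T : SuperOp A A} (hT : IsPPT T) :
    entanglementFidelity T ≤ 1 / Fintype.card A := by
  have hP := isCompletelyPositive_iff.mp hT.transpose
  have h : (∑ i, ∑ j, choi T (i, i) (j, j)).re ≤ Fintype.card A := by
    have hd : (∑ i, ∑ j, choi T (i, j) (i, j)).re = Fintype.card A := by
      rw [sum_choi_diag hT.isChannel.2]; simp
    have hd' : (∑ i, ∑ j, choi T (j, i) (j, i)).re = Fintype.card A := by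
      rw [Finset.sum_comm]; exact hd
    simp only [Complex.re_sum] at hd hd' ⊢
    have : ∀ i j, (choi T (i, i) (j, j)).re ≤
        ((choi T (i, j) (i, j)).re + (choi T (j, i) (j, i)).re) / 2 :=
      fun i j => re_apply_le_of_posSemidef hP (i, j) (j, i)
    calc _ ≤ ∑ i, ∑ j, ((choi T (i, j) (i, j)).re + (choi T (j, i) (j, i)).re) / 2 :=
          Finset.sum_le_sum fun i _ => Finset.sum_le_sum fun j _ => this i j
      _ = _ := by
          simp only [← Finset.sum_div, Finset.sum_add_distrib, hd, hd']
          ring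
  rw [entanglementFidelity_eq]
  rcases Nat.eq_zero_or_pos (Fintype.card A) with h0 | h0
  · simp [h0]
  · have h0' : (0 : ℝ) < Fintype.card A := by exact_mod_cast h0
    rw [div_le_div_iff₀ (by positivity) h0']
    nlinarith

/-- Two families of vectors of norm `√K`, orthogonal within each family and with overlap matrix
the identity, almost exclude each other: the sum of the two (unnormalized) projectors is at most
`K + 1`. -/
theorem posSemidef_sub_add_of_overlap {ι κ : Type*} [Fintype ι] [DecidableEq ι] [Fintype κ]
    [DecidableEq κ] {K : ℝ} (hK : 0 ≤ K) {V W : Matrix ι κ ℂ}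
    (hV : V.conjTranspose * V = (K : ℂ) • 1) (hW : W.conjTranspose * W = (K : ℂ) • 1)
    (hVW : V.conjTranspose * W = 1) :
    (((K + 1 : ℝ) : ℂ) • 1 - (V * V.conjTranspose + W * W.conjTranspose)).PosSemidef := by
  have hWV : W.conjTranspose * V = 1 := by
    simpa using congrArg Matrix.conjTranspose hVW
  set S := V * V.conjTranspose + W * W.conjTranspose with hS
  have hSH : S.conjTranspose = S := by simp [hS]
  have hSS : S * S = (K : ℂ) • S + V * W.conjTranspose + W * V.conjTranspose := by
    have e1 : V * V.conjTranspose * (V * V.conjTranspose) = (K : ℂ) • (V * V.conjTranspose) := by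
      rw [Matrix.mul_assoc, ← Matrix.mul_assoc V.conjTranspose, hV]; simp
    have e2 : W * W.conjTranspose * (W * W.conjTranspose) = (K : ℂ) • (W * W.conjTranspose) := by
      rw [Matrix.mul_assoc, ← Matrix.mul_assoc W.conjTranspose, hW]; simp
    have e3 : V * V.conjTranspose * (W * W.conjTranspose) = V * W.conjTranspose := by
      rw [Matrix.mul_assoc, ← Matrix.mul_assoc V.conjTranspose, hVW]; simp
    have e4 : W * W.conjTranspose * (V * V.conjTranspose) = W * V.conjTranspose := by
      rw [Matrix.mul_assoc, ← Matrix.mul_assoc W.conjTranspose, hWV]; simp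
    rw [hS, add_mul, mul_add, mul_add, e1, e2, e3, e4, smul_add]
    abel
  set R := ((K + 1 : ℝ) : ℂ) • (1 : Matrix ι ι ℂ) - S with hR
  have hRH : R.conjTranspose = R := by
    rw [hR, Matrix.conjTranspose_sub, hSH, Matrix.conjTranspose_smul, Matrix.conjTranspose_one,
      Complex.star_def, Complex.conj_ofReal]
  -- `(K + 1) R` is the sum of squares `R² + (V - W) (V - W)ᴴ`
  have key : R = ((K + 1 : ℝ)⁻¹ : ℝ) •
      (R * R.conjTranspose + (V - W) * (V - W).conjTranspose) := by
    have h : R * R.conjTranspose + (V - W) * (V - W).conjTranspose = ((K + 1 : ℝ) : ℝ) • R := by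
      rw [hRH, Matrix.conjTranspose_sub]
      have : R * R = ((K + 1 : ℝ) : ℂ) ^ 2 • (1 : Matrix ι ι ℂ)
          - (2 * (K + 1 : ℝ) : ℂ) • S + S * S := by
        rw [hR, sub_mul, mul_sub, mul_sub]
        simp only [smul_mul_assoc, one_mul, mul_smul_comm, mul_one, pow_two, mul_smul, two_smul]
        abel
      rw [this, hSS, hR, Matrix.sub_mul V, Matrix.mul_sub V, Matrix.mul_sub W]
      ext x y
      simp only [hS, Matrix.add_apply, Matrix.sub_apply, Matrix.smul_apply, smul_eq_mul,
        Complex.real_smul]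
      push_cast
      ring
    rw [h, smul_smul, inv_mul_cancel₀ (by positivity), one_smul]
  rw [key]
  exact ((Matrix.posSemidef_self_mul_conjTranspose R).add
    (Matrix.posSemidef_self_mul_conjTranspose (V - W))).smul (by positivity)

/-- Monogamy of entanglement: two receivers who see the same channel cannot both be close to
maximally entangled with the sender. -/
theorem IsTwoExtendible.entanglementFidelity_le {T : SuperOp A A} (hT : IsTwoExtendible T) :
    entanglementFidelity T ≤ (Fintype.card A + 1) / (2 * Fintype.card A) := by
  obtain ⟨J, hJ, h₁, h₂⟩ := (isTwoExtendible_iff_choi hT.1).mp hT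
  -- the columns of `V` are `∑ᵢ |i i⟩ ⊗ |e⟩`, those of `W` have the second receiver entangled instead
  let V : Matrix (A × A × A) A ℂ :=
    Matrix.of fun x e => if x.1 = x.2.1 then if x.2.2 = e then 1 else 0 else 0
  let W : Matrix (A × A × A) A ℂ :=
    Matrix.of fun x e => if x.1 = x.2.2 then if x.2.1 = e then 1 else 0 else 0
  have hV : V.conjTranspose * V = ((Fintype.card A : ℝ) : ℂ) • 1 := by
    ext e e'
    simp [V, Matrix.mul_apply, Fintype.sum_prod_type, Matrix.one_apply, apply_ite star, apply_ite Finset.card,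
      eq_comm]
  have hW : W.conjTranspose * W = ((Fintype.card A : ℝ) : ℂ) • 1 := by
    ext e e'
    simp [W, Matrix.mul_apply, Fintype.sum_prod_type, Matrix.one_apply, apply_ite star, apply_ite Finset.card,
      eq_comm]
  have hVW : V.conjTranspose * W = 1 := by
    ext e e'
    simp [V, W, Matrix.mul_apply, Fintype.sum_prod_type, Matrix.one_apply, apply_ite star, eq_comm]
  have hQ := re_trace_mul_nonneg hJ (posSemidef_sub_add_of_overlap (Nat.cast_nonneg _) hV hW hVW)
  have tV : (J * (V * V.conjTranspose)).trace = ∑ i, ∑ j, choi T (i, i) (j, j) := by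
    rw [← Matrix.mul_assoc]
    simp only [← h₁]
    simp [V, Matrix.trace, Matrix.mul_apply, Fintype.sum_prod_type, apply_ite star]
    exact Finset.sum_congr rfl fun _ _ => Finset.sum_comm
  have tW : (J * (W * W.conjTranspose)).trace = ∑ i, ∑ j, choi T (i, i) (j, j) := by
    rw [← Matrix.mul_assoc]
    simp only [← h₂]
    simp [W, Matrix.trace, Matrix.mul_apply, Fintype.sum_prod_type, apply_ite star]
    exact Finset.sum_congr rfl fun _ _ => Finset.sum_comm
  have tJ : J.trace = Fintype.card A := by
    rw [← sum_choi_diag hT.isChannel.2]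
    simp [Matrix.trace, Fintype.sum_prod_type, ← h₁]
  rw [mul_sub, mul_add, Matrix.trace_sub, Matrix.trace_add, tV, tW, mul_smul_comm, mul_one,
    Matrix.trace_smul, tJ, Complex.sub_re, Complex.add_re, smul_eq_mul, Complex.re_ofReal_mul,
    Complex.natCast_re] at hQ
  rw [entanglementFidelity_eq]
  rcases Nat.eq_zero_or_pos (Fintype.card A) with h0 | h0
  · simp [h0]
  · have h0' : (0 : ℝ) < Fintype.card A := by exact_mod_cast h0
    rw [div_le_div_iff₀ (by positivity) (by positivity)]
    nlinarith

end Fidelity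

/-! ### Zero capacity -/

section Capacity

variable {A B : Type*} [Fintype A] [DecidableEq A] [Fintype B]

/-- The capacity vanishes if the fidelity of codes of rank at least two stays away from one. -/
theorem quantumCapacity_eq_zero {N : SuperOp A B}
    (h : ∀ (n K : ℕ) (E : SuperOp (Fin K) (Fin n → A)) (D : SuperOp (Fin n → B) (Fin K)),
      2 ≤ K → IsChannel E → IsChannel D →
        entanglementFidelity (D ∘ₗ tensorPower n N ∘ₗ E) ≤ 3 / 4) :
    quantumCapacity N = 0 := by
  simp only [quantumCapacity, ENNReal.iSup_eq_zero, ENNReal.coe_eq_zero]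
  intro R hR
  by_contra hne
  have hRpos : (0 : ℝ) < R := by exact_mod_cast pos_iff_ne_zero.mpr hne
  -- `ε ≤ R / 2` keeps `R - ε` positive, `ε ≤ 1 / 8` keeps the fidelity above `3 / 4`
  obtain ⟨n, hn, hn0⟩ := ((hR (min ((R : ℝ) / 2) (1 / 8)) (by positivity)).and
    (Filter.eventually_ge_atTop 1)).exists
  obtain ⟨K, E, D, hK, hE, hD, hlog, hF⟩ := hn
  have hK2 : 2 ≤ K := by
    by_contra hlt
    obtain rfl : K = 1 := by omega
    -- rank one has rate zero, below `R - ε`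
    have h1 : min ((R : ℝ) / 2) (1 / 8) ≤ R / 2 := min_le_left _ _
    have h2 : (1 : ℝ) ≤ n := by exact_mod_cast hn0
    simp only [Nat.cast_one, Real.logb_one] at hlog
    nlinarith
  have := h n K E D hK2 hE hD
  have h8 : min ((R : ℝ) / 2) (1 / 8) ≤ 1 / 8 := min_le_right _ _
  linarith

theorem IsPPT.quantumCapacity_eq_zero {N : SuperOp A B} (hN : IsPPT N) :
    quantumCapacity N = 0 := by
  classical
  refine QuantumChannel.quantumCapacity_eq_zero fun n K E D hK hE hD => ?_
  have hK' : (2 : ℝ) ≤ K := by exact_mod_cast hK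
  refine (((hN.tensorPower n).comp_right hE).comp_left hD).entanglementFidelity_le.trans ?_
  rw [Fintype.card_fin, div_le_div_iff₀ (by positivity) (by positivity)]
  linarith

theorem IsTwoExtendible.quantumCapacity_eq_zero {N : SuperOp A B} (hN : IsTwoExtendible N) :
    quantumCapacity N = 0 := by
  classical
  refine QuantumChannel.quantumCapacity_eq_zero fun n K E D hK hE hD => ?_
  have hK' : (2 : ℝ) ≤ K := by exact_mod_cast hK
  refine (((hN.tensorPower n).comp_right hE).comp_left hD).entanglementFidelity_le.trans ?_
  rw [Fintype.card_fin, div_le_div_iff₀ (by positivity) (by positivity)]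
  linarith

end Capacity

/-! ### Erasure -/

section Erase

variable {A B : Type*}

theorem flag_apply [DecidableEq B] (x y : Option B) :
    flag B x y = if x = none then if y = none then 1 else 0 else 0 := by
  simp [flag, Matrix.single_apply, ite_and, eq_comm]

theorem posSemidef_flag [Fintype B] [DecidableEq B] : (flag B).PosSemidef := by
  convert Matrix.posSemidef_vecMulVec_self_star
    (fun x : Option B => if x = none then (1 : ℂ) else 0) using 1
  ext x y
  by_cases hx : x = none <;> by_cases hy : y = none <;>
    simp [flag_apply, Matrix.vecMulVec_apply, hx, hy]

theorem isCompletelyPositive_flagExtend [Fintype B] :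
    IsCompletelyPositive (flagExtend : SuperOp B (Option B)) := by
  classical
  intro r X hX
  let V : Matrix (Fin r × B) (Fin r × Option B) ℂ :=
    Matrix.of fun x y => if some x.2 = y.2 then if x.1 = y.1 then 1 else 0 else 0
  convert hX.conjTranspose_mul_mul_same V using 1
  ext ⟨i, x⟩ ⟨j, y⟩
  rcases x with _ | b <;> rcases y with _ | b' <;>
    simp [ampliate, flagExtend, V, Matrix.mul_apply, Fintype.sum_prod_type, apply_ite star]

variable [Fintype A] [DecidableEq A]

theorem sum_choi_flagExtend_comp [Fintype B] {N : SuperOp A B} (hN : IsTracePreserving N) (a a' : A) :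
    ∑ x, choi (flagExtend ∘ₗ N) (a, x) (a', x) = if a = a' then 1 else 0 := by
  rw [← isTracePreserving_iff.mp hN, Fintype.sum_option]
  simp [choi, flagExtend]

variable [DecidableEq B]

/-- The channel `N` followed by an erasure with probability `q`. -/
def erase (N : SuperOp A B) (q : ℝ) : SuperOp A (Option B) :=
  ((1 - q : ℝ) : ℂ) • flagExtend ∘ₗ N + (q : ℂ) • (Matrix.traceLinearMap A ℂ ℂ).smulRight (flag B)

theorem erasureChannel_eq_erase (q : ℝ) : erasureChannel A q = erase LinearMap.id q := rfl

theorem choi_erase (N : SuperOp A B) (q : ℝ) (x y : A × Option B) :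
    choi (erase N q) x y = ((1 - q : ℝ) : ℂ) * choi (flagExtend ∘ₗ N) x y +
      q * ((if x.1 = y.1 then 1 else 0) * flag B x.2 y.2) := by
  by_cases h : x.1 = y.1 <;>
    simp [choi, erase, h, Matrix.trace_single_eq_same, Matrix.trace_single_eq_of_ne]

theorem transposeOp_comp_erase (N : SuperOp A B) (q : ℝ) :
    transposeOp (Option B) ∘ₗ erase N q = erase (transposeOp B ∘ₗ N) q := by
  apply choi_injective
  ext ⟨a, x⟩ ⟨a', y⟩
  rw [choi_transposeOp_comp, choi_erase, choi_erase]
  rcases x with _ | b <;> rcases y with _ | b' <;> simp [choi, flagExtend, flag_apply]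

theorem choiState_erase (N : SuperOp A B) {k : ℕ} (hk : k ≠ 0) :
    choiState (erase N (1 - 1 / k)) = hybridState k (choiState N) := by
  have hk' : (k : ℂ) ≠ 0 := by exact_mod_cast hk
  simp only [choiState_eq]
  ext ⟨a, x⟩ ⟨a', y⟩
  simp only [hybridState, Matrix.smul_apply, Matrix.add_apply, choi_erase, smul_eq_mul,
    Matrix.kroneckerMap_apply, Matrix.one_apply]
  have h : flagExtendRight ((Fintype.card A : ℂ)⁻¹ • choi N) (a, x) (a', y) =
      (Fintype.card A : ℂ)⁻¹ * choi (flagExtend ∘ₗ N) (a, x) (a', y) := by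
    rcases x with _ | b <;> rcases y with _ | b' <;> simp [choi, flagExtend, flagExtendRight]
  rw [h]
  push_cast
  field_simp
  ring

variable [Fintype B]

theorem isCompletelyPositive_erase {N : SuperOp A B} (hN : IsCompletelyPositive N) {q : ℝ}
    (h0 : 0 ≤ q) (h1 : q ≤ 1) : IsCompletelyPositive (erase N q) := by
  have hC := isCompletelyPositive_iff.mp (isCompletelyPositive_flagExtend.comp hN)
  have hP := posSemidef_mul_apply (Matrix.PosSemidef.one.submatrix (Prod.fst : A × Option B → A))
    (posSemidef_flag.submatrix (Prod.snd : A × Option B → Option B))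
  have h0' : (0 : ℂ) ≤ (q : ℂ) := by exact_mod_cast h0
  have h1' : (0 : ℂ) ≤ ((1 - q : ℝ) : ℂ) := by exact_mod_cast sub_nonneg.mpr h1
  rw [isCompletelyPositive_iff]
  convert (hC.smul h1').add (hP.smul h0') using 1
  ext x y
  simp [choi_erase, Matrix.one_apply]

theorem isTracePreserving_erase {N : SuperOp A B} (hN : IsTracePreserving N) (q : ℝ) :
    IsTracePreserving (erase N q) := by
  rw [isTracePreserving_iff]
  intro a a'
  simp only [choi_erase, Finset.sum_add_distrib, ← Finset.mul_sum, sum_choi_flagExtend_comp hN,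
    Complex.ofReal_sub, Complex.ofReal_one]
  by_cases h : a = a' <;> simp [flag_apply, h]

theorem isChannel_erase {N : SuperOp A B} (hN : IsChannel N) {q : ℝ}
    (h0 : 0 ≤ q) (h1 : q ≤ 1) : IsChannel (erase N q) :=
  ⟨isCompletelyPositive_erase hN.1 h0 h1, isTracePreserving_erase hN.2 q⟩

theorem isPPT_erase {N : SuperOp A B} (hN : IsPPT N) {q : ℝ} (h0 : 0 ≤ q) (h1 : q ≤ 1) :
    IsPPT (erase N q) :=
  ⟨isChannel_erase hN.1 h0 h1, by
    rw [transposeOp_comp_erase]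
    exact isCompletelyPositive_erase hN.2 h0 h1⟩

/-- An erasure of probability at least one half makes a channel two-extendible: the output is handed
to either receiver with probability `1 - q` each, and with probability `2 q - 1` to neither. -/
theorem isTwoExtendible_erase {N : SuperOp A B} (hN : IsChannel N) {q : ℝ} (h0 : 1 / 2 ≤ q)
    (h1 : q ≤ 1) : IsTwoExtendible (erase N q) := by
  have hC := isCompletelyPositive_iff.mp (isCompletelyPositive_flagExtend.comp hN.1)
  have h1' : (0 : ℂ) ≤ ((1 - q : ℝ) : ℂ) := by exact_mod_cast sub_nonneg.mpr h1
  have h2' : (0 : ℂ) ≤ ((2 * q - 1 : ℝ) : ℂ) := by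
    have : 0 ≤ 2 * q - 1 := by linarith
    exact_mod_cast this
  have J₁ := posSemidef_mul_apply
    (hC.submatrix fun x : A × Option B × Option B => (x.1, x.2.1))
    (posSemidef_flag.submatrix fun x : A × Option B × Option B => x.2.2)
  have J₂ := posSemidef_mul_apply
    (hC.submatrix fun x : A × Option B × Option B => (x.1, x.2.2))
    (posSemidef_flag.submatrix fun x : A × Option B × Option B => x.2.1)
  obtain ⟨Δ, hΔ, hΔ'⟩ : ∃ Δ : Matrix A A ℂ, Δ.PosSemidef ∧
      ∀ a a', Δ a a' = if a = a' then 1 else 0 := ⟨1, .one, fun _ _ => Matrix.one_apply⟩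
  have J₃ := posSemidef_mul_apply (posSemidef_mul_apply
    (hΔ.submatrix fun x : A × Option B × Option B => x.1)
    (posSemidef_flag.submatrix fun x : A × Option B × Option B => x.2.1))
    (posSemidef_flag.submatrix fun x : A × Option B × Option B => x.2.2)
  have hf : ∑ x, flag B x x = 1 := by simp [flag_apply]
  refine (isTwoExtendible_iff_choi (isChannel_erase hN (by linarith) h1)).mpr
    ⟨_, ((J₁.smul h1').add (J₂.smul h1')).add (J₃.smul h2'), ?_, ?_⟩
  · intro a b a' b'
    simp only [Matrix.add_apply, Matrix.smul_apply, Matrix.of_apply, Matrix.submatrix_apply,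
      smul_eq_mul, choi_erase]
    simp only [Finset.sum_add_distrib, ← Finset.mul_sum, ← Finset.sum_mul, hf,
      sum_choi_flagExtend_comp hN.2]
    simp only [hΔ']
    push_cast
    ring
  · intro a b a' b'
    simp only [Matrix.add_apply, Matrix.smul_apply, Matrix.of_apply, Matrix.submatrix_apply,
      smul_eq_mul, choi_erase]
    simp only [Finset.sum_add_distrib, ← Finset.mul_sum, ← Finset.sum_mul, hf,
      sum_choi_flagExtend_comp hN.2]
    simp only [hΔ']
    push_cast
    ring

end Erase

theorem isChannel_id {A : Type*} [Fintype A] : IsChannel (LinearMap.id : SuperOp A A) :=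
  ⟨fun _ _ hX => hX, fun _ => rfl⟩

/-! ### The hiding states and their partial transposes -/

section States

variable {A B A' B' : Type*}

/-- The partial transpose on the second system. -/
def partialTranspose (X : Matrix (A × B) (A × B) ℂ) : Matrix (A × B) (A × B) ℂ :=
  Matrix.of fun x y => X (x.1, y.2) (y.1, x.2)

theorem regroup_apply (X : Matrix (A × B) (A × B) ℂ) (Y : Matrix (A' × B') (A' × B') ℂ)
    (x y : (A × A') × (B × B')) : regroup X Y x y =
      X (x.1.1, x.2.1) (y.1.1, y.2.1) * Y (x.1.2, x.2.2) (y.1.2, y.2.2) := rfl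

theorem posSemidef_regroup {X : Matrix (A × B) (A × B) ℂ} {Y : Matrix (A' × B') (A' × B') ℂ}
    (hX : X.PosSemidef) (hY : Y.PosSemidef) : (regroup X Y).PosSemidef :=
  posSemidef_mul_apply
    (hX.submatrix fun x : (A × A') × (B × B') => (x.1.1, x.2.1))
    (hY.submatrix fun x : (A × A') × (B × B') => (x.1.2, x.2.2))

theorem posSemidef_bipartitePower [Fintype A] [Fintype B] (m : ℕ) {ρ : Matrix (A × B) (A × B) ℂ}
    (h : ρ.PosSemidef) : (bipartitePower m ρ).PosSemidef :=
  posSemidef_prod Finset.univ fun t _ =>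
    h.submatrix fun x : (Fin m → A) × (Fin m → B) => (x.1 t, x.2 t)

theorem posSemidef_bipartitePower_sub [Fintype A] [Fintype B] (m : ℕ)
    {ρ σ : Matrix (A × B) (A × B) ℂ} (h : ρ.PosSemidef) (h' : (σ - ρ).PosSemidef) :
    (bipartitePower m σ - bipartitePower m ρ).PosSemidef :=
  posSemidef_prod_sub_prod Finset.univ
    (fun t _ => h.submatrix fun x : (Fin m → A) × (Fin m → B) => (x.1 t, x.2 t))
    (fun t _ => h'.submatrix fun x : (Fin m → A) × (Fin m → B) => (x.1 t, x.2 t))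

theorem bipartitePower_smul (m : ℕ) (c : ℂ) (ρ : Matrix (A × B) (A × B) ℂ) :
    bipartitePower m (c • ρ) = c ^ m • bipartitePower m ρ := by
  ext x y
  simp [bipartitePower, Finset.prod_mul_distrib]

variable (d m : ℕ)

theorem flipOp_conjTranspose : (flipOp d).conjTranspose = flipOp d := by
  ext x y
  simp only [flipOp, Matrix.conjTranspose_apply, Matrix.of_apply, apply_ite star, star_one,
    star_zero]
  exact if_congr ⟨fun h => ⟨h.2.symm, h.1.symm⟩, fun h => ⟨h.2.symm, h.1.symm⟩⟩ rfl rfl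

theorem flipOp_mul_self : flipOp d * flipOp d = 1 := by
  ext ⟨a, b⟩ ⟨a', b'⟩
  simp [flipOp, Matrix.mul_apply, Fintype.sum_prod_type, Matrix.one_apply, ite_and]

theorem posSemidef_symProj : (symProj d).PosSemidef := by
  have h : symProj d = symProj d * (symProj d).conjTranspose := by
    simp only [symProj, Matrix.conjTranspose_smul, Matrix.conjTranspose_add,
      Matrix.conjTranspose_one, flipOp_conjTranspose, smul_mul_smul_comm, add_mul, mul_add,
      flipOp_mul_self, one_mul, mul_one]
    ext x y
    simp
    ring
  rw [h]
  exact Matrix.posSemidef_self_mul_conjTranspose _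

theorem posSemidef_asymProj : (asymProj d).PosSemidef := by
  have h : asymProj d = asymProj d * (asymProj d).conjTranspose := by
    simp only [asymProj, Matrix.conjTranspose_smul, Matrix.conjTranspose_sub,
      Matrix.conjTranspose_one, flipOp_conjTranspose, smul_mul_smul_comm, sub_mul, mul_sub,
      flipOp_mul_self, one_mul, mul_one]
    ext x y
    simp
    ring
  rw [h]
  exact Matrix.posSemidef_self_mul_conjTranspose _

theorem posSemidef_rhoSym : (rhoSym d).PosSemidef :=
  (posSemidef_symProj d).smul (by
    have h : (0 : ℝ) ≤ 2 / ((d : ℝ) ^ 2 + d) := by positivity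
    simpa only [Complex.ofReal_div, Complex.ofReal_add, Complex.ofReal_sub, Complex.ofReal_pow,
      Complex.ofReal_natCast, Complex.ofReal_ofNat, Complex.ofReal_one] using
      Complex.zero_le_real.mpr h)

variable {d}

theorem posSemidef_rhoAsym (hd : 2 ≤ d) : (rhoAsym d).PosSemidef :=
  (posSemidef_asymProj d).smul (by
    have h2 : (2 : ℝ) ≤ d := by exact_mod_cast hd
    have h : (0 : ℝ) ≤ 2 / ((d : ℝ) ^ 2 - d) := div_nonneg (by norm_num) (by nlinarith)
    simpa only [Complex.ofReal_div, Complex.ofReal_add, Complex.ofReal_sub, Complex.ofReal_pow,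
      Complex.ofReal_natCast, Complex.ofReal_ofNat, Complex.ofReal_one] using
      Complex.zero_le_real.mpr h)

theorem posSemidef_tau1 (hd : 2 ≤ d) : (tau1 d m).PosSemidef :=
  posSemidef_bipartitePower m
    (((posSemidef_rhoSym d).add (posSemidef_rhoAsym hd)).smul (by
      have h : (0 : ℝ) ≤ 1 / 2 := by norm_num
      simpa only [Complex.ofReal_div, Complex.ofReal_add, Complex.ofReal_sub, Complex.ofReal_pow,
        Complex.ofReal_natCast, Complex.ofReal_ofNat, Complex.ofReal_one] using
        Complex.zero_le_real.mpr h))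

variable (d) in
theorem posSemidef_tau2 : (tau2 d m).PosSemidef :=
  posSemidef_bipartitePower m (posSemidef_rhoSym d)

/-- The operator `∑ᵢⱼ |ii⟩⟨jj|`, which is `d` times the projector onto the maximally entangled
vector and the partial transpose of the flip. -/
def flipPT (d : ℕ) : Matrix (Fin d × Fin d) (Fin d × Fin d) ℂ :=
  Matrix.of fun x y => if x.1 = x.2 then if y.1 = y.2 then 1 else 0 else 0

theorem partialTranspose_flipOp : partialTranspose (flipOp d) = flipPT d := by
  ext x y
  simp [partialTranspose, flipOp, flipPT, ite_and, eq_comm]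

theorem partialTranspose_one :
    partialTranspose (1 : Matrix (Fin d × Fin d) (Fin d × Fin d) ℂ) = 1 := by
  ext ⟨a, b⟩ ⟨a', b'⟩
  simp [partialTranspose, Matrix.one_apply, eq_comm]

theorem flipPT_conjTranspose : (flipPT d).conjTranspose = flipPT d := by
  ext ⟨a, b⟩ ⟨a', b'⟩
  by_cases h : a = b <;> by_cases h' : a' = b' <;> simp [flipPT, h, h']

theorem flipPT_mul_self : flipPT d * flipPT d = (d : ℂ) • flipPT d := by
  ext ⟨a, b⟩ ⟨a', b'⟩
  by_cases h : a = b <;> by_cases h' : a' = b' <;>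
    simp [flipPT, Matrix.mul_apply, Fintype.sum_prod_type, h, h']

theorem posSemidef_flipPT : (flipPT d).PosSemidef := by
  convert Matrix.posSemidef_vecMulVec_self_star
    (fun x : Fin d × Fin d => if x.1 = x.2 then (1 : ℂ) else 0) using 1
  ext ⟨a, b⟩ ⟨a', b'⟩
  by_cases h : a = b <;> by_cases h' : a' = b' <;>
    simp [flipPT, Matrix.vecMulVec_apply, h, h']

/-- As `flipPT d` has square `d • flipPT d`, the operator `d - flipPT d` is `1 / d` times its own
square. -/
theorem posSemidef_smul_one_sub_flipPT (hd : 0 < d) :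
    ((d : ℂ) • 1 - flipPT d).PosSemidef := by
  have h : (d : ℂ) • 1 - flipPT d = ((d : ℝ)⁻¹ : ℝ) •
      (((d : ℂ) • 1 - flipPT d) * ((d : ℂ) • 1 - flipPT d).conjTranspose) := by
    have hd' : (d : ℂ) ≠ 0 := by exact_mod_cast hd.ne'
    simp only [Matrix.conjTranspose_sub, Matrix.conjTranspose_smul, Matrix.conjTranspose_one,
      flipPT_conjTranspose, mul_sub, sub_mul, flipPT_mul_self, smul_mul_assoc, mul_smul_comm,
      one_mul, mul_one]
    ext x y
    simp [Complex.real_smul]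
    field_simp
  rw [h]
  exact (Matrix.posSemidef_self_mul_conjTranspose _).smul (by positivity)

theorem partialTranspose_rhoSym :
    partialTranspose (rhoSym d) = (1 / ((d : ℂ) ^ 2 + d)) • (1 + flipPT d) := by
  have h : partialTranspose (rhoSym d) = (2 / ((d : ℂ) ^ 2 + d)) • (1 / 2 : ℂ) •
      (partialTranspose 1 + partialTranspose (flipOp d)) := rfl
  rw [h, partialTranspose_one, partialTranspose_flipOp, smul_smul]
  congr 1
  ring

theorem partialTranspose_rhoAsym :
    partialTranspose (rhoAsym d) = (1 / ((d : ℂ) ^ 2 - d)) • (1 - flipPT d) := by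
  have h : partialTranspose (rhoAsym d) = (2 / ((d : ℂ) ^ 2 - d)) • (1 / 2 : ℂ) •
      (partialTranspose 1 - partialTranspose (flipOp d)) := rfl
  rw [h, partialTranspose_one, partialTranspose_flipOp, smul_smul]
  congr 1
  ring

theorem partialTranspose_average (hd : 2 ≤ d) :
    partialTranspose ((1 / 2 : ℂ) • (rhoSym d + rhoAsym d)) =
      ((1 / (d * (d ^ 2 - 1)) : ℝ) : ℂ) • ((d : ℂ) • 1 - flipPT d) := by
  have h : partialTranspose ((1 / 2 : ℂ) • (rhoSym d + rhoAsym d)) =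
      (1 / 2 : ℂ) • (partialTranspose (rhoSym d) + partialTranspose (rhoAsym d)) := rfl
  -- with `d = 2 + e` the factors of all denominators visibly do not vanish
  obtain ⟨e, rfl⟩ := Nat.exists_eq_add_of_le hd
  have h0 : ((2 : ℂ) + e) ≠ 0 := by exact_mod_cast (by omega : 2 + e ≠ 0)
  have h1 : ((1 : ℂ) + e) ≠ 0 := by exact_mod_cast (by omega : 1 + e ≠ 0)
  have h3 : ((3 : ℂ) + e) ≠ 0 := by exact_mod_cast (by omega : 3 + e ≠ 0)
  rw [h, partialTranspose_rhoSym, partialTranspose_rhoAsym]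
  ext x y
  simp only [Matrix.smul_apply, Matrix.add_apply, Matrix.sub_apply, smul_eq_mul]
  push_cast
  rw [show ((2 : ℂ) + e) ^ 2 + (2 + e) = (2 + e) * (3 + e) by ring,
    show ((2 : ℂ) + e) ^ 2 - (2 + e) = (2 + e) * (1 + e) by ring,
    show ((2 : ℂ) + e) ^ 2 - 1 = (3 + e) * (1 + e) by ring]
  field_simp
  ring

theorem posSemidef_partialTranspose_average (hd : 2 ≤ d) :
    (partialTranspose ((1 / 2 : ℂ) • (rhoSym d + rhoAsym d))).PosSemidef := by
  rw [partialTranspose_average hd]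
  refine (posSemidef_smul_one_sub_flipPT (by omega)).smul ?_
  have h2 : (2 : ℝ) ≤ d := by exact_mod_cast hd
  have : (0 : ℝ) ≤ 1 / (d * (d ^ 2 - 1)) :=
    div_nonneg zero_le_one (mul_nonneg (by linarith) (by nlinarith))
  exact_mod_cast this

theorem posSemidef_partialTranspose_rhoSym : (partialTranspose (rhoSym d)).PosSemidef := by
  rw [partialTranspose_rhoSym]
  refine (Matrix.PosSemidef.one.add posSemidef_flipPT).smul ?_
  have h : (0 : ℝ) ≤ 1 / ((d : ℝ) ^ 2 + d) := by positivity
  simpa only [Complex.ofReal_div, Complex.ofReal_add, Complex.ofReal_sub, Complex.ofReal_pow,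
    Complex.ofReal_natCast, Complex.ofReal_ofNat, Complex.ofReal_one] using
    Complex.zero_le_real.mpr h

/-- On a single shield factor, the partial transpose of `(ρ_s + ρ_a) / 2` is at most `d / (d - 1)`
times the one of `ρ_s`. -/
theorem posSemidef_partialTranspose_sub (hd : 2 ≤ d) :
    (((d / (d - 1) : ℝ) : ℂ) • partialTranspose (rhoSym d) -
      partialTranspose ((1 / 2 : ℂ) • (rhoSym d + rhoAsym d))).PosSemidef := by
  have h : ((d / (d - 1) : ℝ) : ℂ) • partialTranspose (rhoSym d) -
      partialTranspose ((1 / 2 : ℂ) • (rhoSym d + rhoAsym d)) =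
      ((1 / (d * (d - 1)) : ℝ) : ℂ) • flipPT d := by
    rw [partialTranspose_average hd, partialTranspose_rhoSym]
    obtain ⟨e, rfl⟩ := Nat.exists_eq_add_of_le hd
    have h0 : ((2 : ℂ) + e) ≠ 0 := by exact_mod_cast (by omega : 2 + e ≠ 0)
    have h1 : ((1 : ℂ) + e) ≠ 0 := by exact_mod_cast (by omega : 1 + e ≠ 0)
    have h3 : ((3 : ℂ) + e) ≠ 0 := by exact_mod_cast (by omega : 3 + e ≠ 0)
    ext x y
    simp only [Matrix.smul_apply, Matrix.add_apply, Matrix.sub_apply, smul_eq_mul]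
    push_cast
    rw [show ((2 : ℂ) + e) ^ 2 + (2 + e) = (2 + e) * (3 + e) by ring,
      show ((2 : ℂ) + e) - 1 = 1 + e by ring,
      show ((2 : ℂ) + e) ^ 2 - 1 = (3 + e) * (1 + e) by ring]
    field_simp
    ring
  rw [h]
  refine posSemidef_flipPT.smul ?_
  have h2 : (2 : ℝ) ≤ d := by exact_mod_cast hd
  have : (0 : ℝ) ≤ 1 / (d * (d - 1)) :=
    div_nonneg zero_le_one (mul_nonneg (by linarith) (by linarith))
  exact_mod_cast this

theorem posSemidef_partialTranspose_tau1 (hd : 2 ≤ d) :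
    (partialTranspose (tau1 d m)).PosSemidef :=
  -- the partial transpose of a tensor power is the tensor power of the partial transposes
  posSemidef_bipartitePower m (posSemidef_partialTranspose_average hd)

theorem posSemidef_partialTranspose_tau2 : (partialTranspose (tau2 d m)).PosSemidef :=
  posSemidef_bipartitePower m posSemidef_partialTranspose_rhoSym

theorem posSemidef_partialTranspose_tau_sub (hd : 2 ≤ d) :
    (((((d : ℝ) / (d - 1)) ^ m : ℝ) : ℂ) • partialTranspose (tau2 d m) -
      partialTranspose (tau1 d m)).PosSemidef := by
  have h := posSemidef_bipartitePower_sub m (posSemidef_partialTranspose_average hd)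
    (posSemidef_partialTranspose_sub hd)
  rw [bipartitePower_smul, ← Complex.ofReal_pow] at h
  exact h

/-! ### The approximate private bit -/

/-- The projector onto `(|01⟩ ± |10⟩) / √2`. -/
def oddBell (s : ℤˣ) : Matrix (Fin 2 × Fin 2) (Fin 2 × Fin 2) ℂ :=
  Matrix.of fun x y => if x.1 = x.2 then 0 else if y.1 = y.2 then 0 else
    if x.1 = y.1 then 1 / 2 else ((s : ℤ) : ℂ) / 2

/-- The projector onto the span of `|00⟩` and `|11⟩`. -/
def evenProj : Matrix (Fin 2 × Fin 2) (Fin 2 × Fin 2) ℂ :=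
  Matrix.diagonal fun x => if x.1 = x.2 then 1 else 0

theorem posSemidef_evenProj : evenProj.PosSemidef :=
  Matrix.PosSemidef.diagonal fun x => by
    by_cases h : x.1 = x.2 <;> simp [h]

theorem posSemidef_oddBell (s : ℤˣ) : (oddBell s).PosSemidef := by
  have h := (Matrix.posSemidef_vecMulVec_self_star (fun x : Fin 2 × Fin 2 =>
    if x.1 = x.2 then (0 : ℂ) else if x.1 = 0 then 1 else ((s : ℤ) : ℂ))).smul
    (show (0 : ℝ) ≤ 1 / 2 by norm_num)
  convert h using 1
  ext ⟨a, b⟩ ⟨a', b'⟩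
  rcases Int.units_eq_one_or s with rfl | rfl <;>
  fin_cases a <;> fin_cases b <;> fin_cases a' <;> fin_cases b' <;>
    simp [oddBell, Matrix.vecMulVec_apply, Complex.real_smul] <;> norm_num

theorem posSemidef_omegaSep : omegaSep.PosSemidef := by
  have h : omegaSep = (1 / 2 : ℝ) • (oddBell 1 + oddBell (-1)) := by
    ext ⟨a, b⟩ ⟨a', b'⟩
    fin_cases a <;> fin_cases b <;> fin_cases a' <;> fin_cases b' <;>
      simp [oddBell, omegaSep, Complex.real_smul] <;> norm_num
  rw [h]
  exact ((posSemidef_oddBell 1).add (posSemidef_oddBell (-1))).smul (by norm_num)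

theorem bell_apply (s : ℤˣ) (x y : Fin 2 × Fin 2) :
    bell s x y = if x.1 = x.2 then if y.1 = y.2 then
      if x.1 = y.1 then 1 / 2 else ((s : ℤ) : ℂ) / 2 else 0 else 0 := by
  have h2 : ((Real.sqrt 2 : ℝ) : ℂ) * ((Real.sqrt 2 : ℝ) : ℂ) = 2 := by
    rw [← Complex.ofReal_mul, Real.mul_self_sqrt (by norm_num)]; simp
  have h3 : (((Real.sqrt 2 : ℝ) : ℂ))⁻¹ * ((Real.sqrt 2 : ℝ) : ℂ)⁻¹ = 1 / 2 := by
    rw [← mul_inv, h2]; norm_num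
  obtain ⟨a, b⟩ := x
  obtain ⟨a', b'⟩ := y
  rcases Int.units_eq_one_or s with rfl | rfl <;>
  fin_cases a <;> fin_cases b <;> fin_cases a' <;> fin_cases b' <;>
    simp [bell, bellVec, Matrix.vecMulVec_apply, div_eq_mul_inv, h3]

theorem partialTranspose_bell (s : ℤˣ) : partialTranspose (bell s) =
    (1 / 2 : ℂ) • (evenProj + oddBell s - oddBell (-s)) := by
  ext ⟨a, b⟩ ⟨a', b'⟩
  fin_cases a <;> fin_cases b <;> fin_cases a' <;> fin_cases b' <;>
    simp [partialTranspose, bell_apply, oddBell, evenProj] <;> ring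

theorem partialTranspose_omegaSep (s : ℤˣ) : partialTranspose omegaSep =
    (1 / 2 : ℂ) • (oddBell s + oddBell (-s)) := by
  ext ⟨a, b⟩ ⟨a', b'⟩
  fin_cases a <;> fin_cases b <;> fin_cases a' <;> fin_cases b' <;>
    simp [partialTranspose, omegaSep, oddBell, Matrix.single_apply] <;> ring

theorem posSemidef_gammaState (s : ℤˣ) {p : ℝ} (hp0 : 0 ≤ p) (hp1 : p ≤ 1) (hd : 2 ≤ d) :
    (gammaState s p d m).PosSemidef := by
  have hb : ∀ s, (bell s).PosSemidef := fun s => Matrix.posSemidef_vecMulVec_self_star _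
  have h0 : (0 : ℂ) ≤ ((p / 2 : ℝ) : ℂ) := by exact_mod_cast div_nonneg hp0 zero_le_two
  have h1 : (0 : ℂ) ≤ ((1 - p : ℝ) : ℂ) := by exact_mod_cast sub_nonneg.mpr hp1
  exact (((posSemidef_regroup (hb s) (posSemidef_tau1 m hd)).add
    (posSemidef_regroup (hb (-s)) (posSemidef_tau2 d m))).smul h0).add
    ((posSemidef_regroup posSemidef_omegaSep (posSemidef_tau2 d m)).smul h1)

/-- The partial transpose of `γ_±` is block diagonal with respect to the key: on `|00⟩`, `|11⟩` the
shield carries `τ₁ + τ₂`, and on the two odd Bell vectors it carries nonnegative multiples of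
`p τ₁ + (2 - 3 p) τ₂` and `(2 - p) τ₂ - p τ₁`, all partially transposed. -/
theorem posSemidef_partialTranspose_gammaState (s : ℤˣ) {p : ℝ} (hp0 : 0 < p) (hp1 : p ≤ 2 / 3)
    (hd : 2 ≤ d) (hp2 : ((d : ℝ) / (d - 1)) ^ m ≤ (2 - p) / p) :
    (partialTranspose (gammaState s p d m)).PosSemidef := by
  have h1 := posSemidef_partialTranspose_tau1 m hd
  have h2 := posSemidef_partialTranspose_tau2 (d := d) m
  have h3 := posSemidef_partialTranspose_tau_sub m hd
  have hc : 0 ≤ (2 - p) - p * ((d : ℝ) / (d - 1)) ^ m := by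
    rw [le_div_iff₀ hp0] at hp2
    linarith
  have hodd := (h1.smul (show 0 ≤ p / 4 by positivity)).add
    (h2.smul (show 0 ≤ (2 - 3 * p) / 4 by linarith))
  have hodd' := (h3.smul (show 0 ≤ p / 4 by positivity)).add
    (h2.smul (show 0 ≤ ((2 - p) - p * ((d : ℝ) / (d - 1)) ^ m) / 4 by linarith))
  have h := (((posSemidef_regroup posSemidef_evenProj (h1.add h2)).smul
    (show 0 ≤ p / 4 by positivity)).add
    (posSemidef_regroup (posSemidef_oddBell s) hodd)).add
    (posSemidef_regroup (posSemidef_oddBell (-s)) hodd')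
  convert h using 1
  have hb : ∀ s, ∀ a b a' b', bell s (a, b') (a', b) =
      (1 / 2 : ℂ) * (evenProj (a, b) (a', b') + oddBell s (a, b) (a', b')
        - oddBell (-s) (a, b) (a', b')) := fun s a b a' b' =>
    congrFun (congrFun (partialTranspose_bell s) (a, b)) (a', b')
  have ho : ∀ a b a' b', omegaSep (a, b') (a', b) =
      (1 / 2 : ℂ) * (oddBell s (a, b) (a', b') + oddBell (-s) (a, b) (a', b')) :=
    fun a b a' b' => congrFun (congrFun (partialTranspose_omegaSep s) (a, b)) (a', b')
  ext x y
  simp only [partialTranspose, gammaState, Matrix.of_apply, Matrix.add_apply, Matrix.smul_apply,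
    Matrix.sub_apply, regroup_apply, hb, ho, neg_neg, smul_eq_mul, Complex.real_smul]
  push_cast
  ring

/-! ### Marginals of the private bit -/

theorem sum_bell (s : ℤˣ) (a a' : Fin 2) :
    ∑ b, bell s (a, b) (a', b) = if a = a' then 1 / 2 else 0 := by
  fin_cases a <;> fin_cases a' <;> simp [bell_apply]

theorem sum_omegaSep (a a' : Fin 2) :
    ∑ b, omegaSep (a, b) (a', b) = if a = a' then 1 / 2 else 0 := by
  fin_cases a <;> fin_cases a' <;> simp [omegaSep, Matrix.single_apply]

theorem sum_rhoSym (hd : 2 ≤ d) (a a' : Fin d) :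
    ∑ b, rhoSym d (a, b) (a', b) = if a = a' then 1 / (d : ℂ) else 0 := by
  have h0 : (d : ℂ) ≠ 0 := by exact_mod_cast (by omega : d ≠ 0)
  have h1 : (d : ℂ) + 1 ≠ 0 := by exact_mod_cast (by omega : d + 1 ≠ 0)
  simp only [rhoSym, symProj, flipOp, Matrix.smul_apply, Matrix.add_apply, Matrix.of_apply,
    Matrix.one_apply, smul_eq_mul, ← Finset.mul_sum, Finset.sum_add_distrib, Prod.mk.injEq]
  by_cases h : a = a'
  · simp [h, show (d : ℂ) ^ 2 + d = d * (d + 1) by ring, ite_and]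
    field_simp
  · simp [h, ite_and]

theorem sum_rhoAsym (hd : 2 ≤ d) (a a' : Fin d) :
    ∑ b, rhoAsym d (a, b) (a', b) = if a = a' then 1 / (d : ℂ) else 0 := by
  have h0 : (d : ℂ) ≠ 0 := by exact_mod_cast (by omega : d ≠ 0)
  have h1 : (d : ℂ) - 1 ≠ 0 := sub_ne_zero.mpr (by exact_mod_cast (by omega : d ≠ 1))
  simp only [rhoAsym, asymProj, flipOp, Matrix.smul_apply, Matrix.sub_apply, Matrix.of_apply,
    Matrix.one_apply, smul_eq_mul, ← Finset.mul_sum, Finset.sum_sub_distrib, Prod.mk.injEq]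
  by_cases h : a = a'
  · simp [h, show (d : ℂ) ^ 2 - d = d * (d - 1) by ring, ite_and]
    field_simp
  · simp [h, ite_and]

theorem sum_bipartitePower {A B : Type*} [DecidableEq A] [Fintype B]
    {ρ : Matrix (A × B) (A × B) ℂ} {c : ℂ}
    (h : ∀ a a', ∑ b, ρ (a, b) (a', b) = if a = a' then c else 0) (a a' : Fin m → A) :
    ∑ b, bipartitePower m ρ (a, b) (a', b) = if a = a' then c ^ m else 0 := by
  simp only [bipartitePower, Matrix.of_apply]
  rw [← Fintype.piFinset_univ, ← Finset.prod_univ_sum (fun _ => Finset.univ)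
    (fun t b => ρ (a t, b) (a' t, b))]
  simp only [h, Finset.prod_ite_zero, Finset.prod_const, Finset.card_univ, Fintype.card_fin,
    Finset.mem_univ, true_imp_iff, funext_iff]

theorem sum_tau1 (hd : 2 ≤ d) (a a' : Fin m → Fin d) :
    ∑ b, tau1 d m (a, b) (a', b) = if a = a' then (1 / (d : ℂ)) ^ m else 0 := by
  refine sum_bipartitePower m (fun a a' => ?_) a a'
  simp only [Matrix.smul_apply, Matrix.add_apply, smul_eq_mul, ← Finset.mul_sum,
    Finset.sum_add_distrib, sum_rhoSym hd, sum_rhoAsym hd]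
  split_ifs <;> ring

theorem sum_tau2 (hd : 2 ≤ d) (a a' : Fin m → Fin d) :
    ∑ b, tau2 d m (a, b) (a', b) = if a = a' then (1 / (d : ℂ)) ^ m else 0 :=
  sum_bipartitePower m (sum_rhoSym hd) a a'

/-- The first marginal of `γ_±` is maximally mixed, so that `γ_±` is a Choi state. -/
theorem sum_gammaState (s : ℤˣ) (p : ℝ) (hd : 2 ≤ d) (a a' : KeyShield d m) :
    ∑ b, gammaState s p d m (a, b) (a', b) =
      if a = a' then (Fintype.card (KeyShield d m) : ℂ)⁻¹ else 0 := by
  obtain ⟨i, u⟩ := a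
  obtain ⟨i', u'⟩ := a'
  simp only [gammaState, Matrix.add_apply, Matrix.smul_apply, regroup_apply, smul_eq_mul,
    Finset.sum_add_distrib, ← Finset.mul_sum, Fintype.sum_prod_type, ← Finset.sum_mul,
    sum_bell, sum_omegaSep, sum_tau1 m hd, sum_tau2 m hd]
  by_cases h : i = i' <;> by_cases h' : u = u' <;> simp [h, h']
  ring

end States

/-! ### Channels with a given Choi state -/

section ChoiState

variable {A B : Type*} [Fintype A] [DecidableEq A] [Nonempty A]

theorem choiState_injective : Function.Injective (choiState : SuperOp A B → _) :=
  fun _ _ h => choi_injective ((choi_eq_of_choiState_eq h).trans (choi_eq_of_choiState_eq rfl).symm)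

variable [Fintype B]

/-- A state whose first marginal is maximally mixed is the Choi state of a channel. -/
theorem exists_isChannel_choiState {ρ : Matrix (A × B) (A × B) ℂ} (hρ : ρ.PosSemidef)
    (h : ∀ a a', ∑ b, ρ (a, b) (a', b) = if a = a' then (Fintype.card A : ℂ)⁻¹ else 0) :
    ∃ N : SuperOp A B, IsChannel N ∧ choiState N = ρ := by
  have hA : (Fintype.card A : ℂ) ≠ 0 := by simp
  refine ⟨ofChoi ((Fintype.card A : ℂ) • ρ), ⟨?_, ?_⟩, ?_⟩
  · rw [isCompletelyPositive_iff, choi_ofChoi]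
    exact hρ.smul (Nat.cast_nonneg _)
  · rw [isTracePreserving_iff]
    intro a a'
    simp only [choi_ofChoi, Matrix.smul_apply, smul_eq_mul, ← Finset.mul_sum, h]
    by_cases h : a = a' <;> simp [h]
  · rw [choiState_eq, choi_ofChoi, smul_smul, inv_mul_cancel₀ hA, one_smul]

/-- Up to normalization, the partial transpose of the Choi state is the Choi matrix of the channel
followed by the transpose. -/
theorem IsChannel.isPPT {N : SuperOp A B} (hN : IsChannel N)
    (h : (partialTranspose (choiState N)).PosSemidef) : IsPPT N := by
  refine ⟨hN, ?_⟩
  have e : choi (transposeOp B ∘ₗ N) =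
      (Fintype.card A : ℂ) • partialTranspose (choiState N) := by
    ext x y
    rw [choi_transposeOp_comp, choi_eq_of_choiState_eq rfl]
    rfl
  rw [isCompletelyPositive_iff, e]
  exact h.smul (Nat.cast_nonneg _)

end ChoiState

end QuantumChannel

end

theorem mainTheorem3
    (k : ℕ) (hk : 2 ≤ k)
    (d m : ℕ) (hd : 2 ≤ d) (p : ℝ) (hp0 : 0 < p) (hp1 : p ≤ 2 / 3)
    (hp2 : ((d : ℝ) / (d - 1)) ^ m ≤ (2 - p) / p)
    (s : ℤˣ) (d' m' : ℕ) (hd' : 2 ≤ d') (p' : ℝ) (hp0' : 0 < p') (hp1' : p' ≤ 2 / 3)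
    (hp2' : ((d' : ℝ) / (d' - 1)) ^ m' ≤ (2 - p') / p') :
    (∃ N_H : QuantumChannel.SuperOp (QuantumChannel.KeyShield d m)
        (Option (QuantumChannel.KeyShield d m)),
      QuantumChannel.IsChannel N_H ∧
      QuantumChannel.choiState N_H =
        QuantumChannel.hybridState k (QuantumChannel.gammaState 1 p d m)) ∧
    (∃ N_γ : QuantumChannel.SuperOp (QuantumChannel.KeyShield d' m')
        (QuantumChannel.KeyShield d' m'),
      QuantumChannel.IsChannel N_γ ∧
      QuantumChannel.choiState N_γ = QuantumChannel.gammaState s p' d' m') ∧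
    ∀ (N_H : QuantumChannel.SuperOp (QuantumChannel.KeyShield d m)
          (Option (QuantumChannel.KeyShield d m)))
      (N_γ : QuantumChannel.SuperOp (QuantumChannel.KeyShield d' m')
          (QuantumChannel.KeyShield d' m')),
      QuantumChannel.IsChannel N_H →
      QuantumChannel.choiState N_H =
        QuantumChannel.hybridState k (QuantumChannel.gammaState 1 p d m) →
      QuantumChannel.IsChannel N_γ →
      QuantumChannel.choiState N_γ = QuantumChannel.gammaState s p' d' m' →
      QuantumChannel.quantumCapacity N_H = 0 ∧
      QuantumChannel.quantumCapacity (QuantumChannel.tensor N_H N_γ) = 0 ∧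
      ∀ (D : ℕ) (q : ℝ), 1 ≤ D → 1 / 2 ≤ q → q < 1 →
        QuantumChannel.quantumCapacity
          (QuantumChannel.tensor N_H (QuantumChannel.erasureChannel (Fin D) q)) = 0 := by
  have hkR : (2 : ℝ) ≤ k := by exact_mod_cast hk
  have hq : 1 / 2 ≤ 1 - 1 / (k : ℝ) := by
    have : 1 / (k : ℝ) ≤ 1 / 2 := one_div_le_one_div_of_le (by norm_num) hkR
    linarith
  have hq' : 1 - 1 / (k : ℝ) ≤ 1 := sub_le_self _ (by positivity)
  have : NeZero d := ⟨by omega⟩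
  have : NeZero d' := ⟨by omega⟩
  -- `N` is the channel of `γ_+`; the hybrid state is its Choi state after an erasure of
  -- probability `1 - 1 / k ≥ 1 / 2`
  obtain ⟨N, hN, hNγ⟩ := QuantumChannel.exists_isChannel_choiState
    (QuantumChannel.posSemidef_gammaState m 1 hp0.le (by linarith) hd)
    (QuantumChannel.sum_gammaState m 1 p hd)
  have hNH : QuantumChannel.choiState (QuantumChannel.erase N (1 - 1 / k)) =
      QuantumChannel.hybridState k (QuantumChannel.gammaState 1 p d m) := by
    rw [QuantumChannel.choiState_erase N (by omega), hNγ]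
  refine ⟨⟨_, QuantumChannel.isChannel_erase hN (by linarith) hq', hNH⟩,
    QuantumChannel.exists_isChannel_choiState
      (QuantumChannel.posSemidef_gammaState m' s hp0'.le (by linarith) hd')
      (QuantumChannel.sum_gammaState m' s p' hd'), ?_⟩
  intro N_H N_γ _ hH hγ hγ'
  -- the Choi state determines the hybrid channel: it is `N` followed by an erasure
  obtain rfl := QuantumChannel.choiState_injective (hH.trans hNH.symm)
  have hNppt : QuantumChannel.IsPPT N := hN.isPPT (by
    rw [hNγ]
    exact QuantumChannel.posSemidef_partialTranspose_gammaState m 1 hp0 hp1 hd hp2)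
  have hγppt : QuantumChannel.IsPPT N_γ := hγ.isPPT (by
    rw [hγ']
    exact QuantumChannel.posSemidef_partialTranspose_gammaState m' s hp0' hp1' hd' hp2')
  have hppt := QuantumChannel.isPPT_erase hNppt (by linarith) hq'
  refine ⟨hppt.quantumCapacity_eq_zero, (hppt.tensor hγppt).quantumCapacity_eq_zero, ?_⟩
  intro D q _ hq1 hq2
  rw [QuantumChannel.erasureChannel_eq_erase]
  exact ((QuantumChannel.isTwoExtendible_erase hN hq hq').tensor
    (QuantumChannel.isTwoExtendible_erase QuantumChannel.isChannel_id hq1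
      hq2.le)).quantumCapacity_eq_zero
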